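/- **Conventions.** An ordering of a finite simple graph $G=(V,E)$ is a bijection $f:V\to\{1,\dots,|V|\}$; its bandwidth is $\max_{uv\in E}|f(u)-f(v)|$ ($0$ if $E=\emptyset$), and $\mathrm{bw}(G)$ is the minimum bandwidth of an ordering of $G$. The problem Bandwidth asks, given $G$, for an ordering of minimum bandwidth; the size of an instance is $|V|$. For $f:\mathbb R\to\mathbb R$, a polynomial-time $(r,f)$-reduction of a minimization problem consists of two polynomial-time algorithms. The reducer transforms an instance $I$ into finitely many instances $I_1,\dots,I_m$ of size at most $s(I)/r+O(1)$ (and may compute additional information). For every $\alpha\ge 1$, given solutions of $I_1,\dots,I_m$ with costs at most $\alpha\,\mathrm{OPT}_{I_1},\dots,\alpha\,\mathrm{OPT}_{I_m}$, the merger (which may use $I$ and the additional information, but is not given $\alpha$) transforms them into a solution of $I$ of cost at most $f(\alpha)\,\mathrm{OPT}_I$. Polynomial time means polynomially many steps of a unit-cost random access machine with addition and subtraction, in the bit length of the input; graphs are given by adjacency matrices. For $\rho:V\to V$ let $G/\rho$ be the simple graph on $\{v:\rho(v)=v\}$ obtained by identifying each $v$ with $\rho(v)$ (dropping loops and multiple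 edges). Call $\rho$ a *contraction map* of $G$ if $\rho\circ\rho=\rho$, every $v$ is at distance at most $2$ from $\rho(v)$, every fibre $\rho^{-1}(v)$ has at most $3$ elements, and $|\{v:\rho(v)=v\}|\le |V|/2$. **Theorem.** 1. Let $G$ be a finite graph without isolated vertices and with $\mathrm{bw}(G)\ge 2$, and let $M$ be a maximum cardinality matching of $G$. Then there is a contraction map $\rho$ of $G$ such that for every $uw\in M$ either $\rho(u)=\rho(w)=u$ or $\rho(u)=\rho(w)=w$, and such that $\mathrm{bw}(G/\rho)\le 3\,\mathrm{bw}(G)-1$. 2. There is a polynomial-time $(2,f)$-reduction for Bandwidth with $f(\alpha)=9\alpha$ whose reducer creates, for every graph $G$, exactly one instance $G'$, where $|V(G')|\le |V(G)|/2$. If $\mathrm{bw}(G)\ge 2$, then moreover $G'$ is isomorphic to $G_0/\rho$ for a contraction map $\rho$ of the graph $G_0$ obtained from $G$ by removing the isolated vertices, and $\mathrm{bw}(G')\le 3\,\mathrm{bw}(G)-1$. 3. For every $k\in\mathbb N$ there is a polynomial-time $(2^k,f_k)$-reduction for Bandwidth with $f_k(\alpha)=9^k\alpha$, in which all created instances have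 at most $|V(G)|/2^k$ vertices. (So optimal solutions of the created instances yield a $9^k$-approximation.) -/

import Mathlib

noncomputable section

/-! ## Orderings and bandwidth -/

/-- An ordering of the vertices: a bijection onto `{0, …, |V| - 1}`. -/
abbrev VertexOrdering (V : Type*) := V ≃ Fin (Nat.card V)

/-- The bandwidth of an ordering `f`: the maximum of `|f u - f v|` over the edges `uv`, and `0` if
there are no edges. (The set is bounded by `Nat.card V`, so the supremum is never a junk value.) -/
def orderingBandwidth {V : Type*} (G : SimpleGraph V) (f : VertexOrdering V) : ℕ :=
  sSup {d : ℕ | ∃ u v, G.Adj u v ∧ d = Nat.dist (f u : ℕ) (f v : ℕ)}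

/-- The bandwidth of a finite graph: the minimum of the bandwidths of its orderings. -/
def graphBandwidth {V : Type*} (G : SimpleGraph V) : ℕ :=
  sInf (Set.range fun f : VertexOrdering V => orderingBandwidth G f)

/-! ## Contractions -/

/-- The graph obtained from `G` by identifying every vertex `v` with `ρ v` (loops and multiple edges
are dropped). Its vertices are the fixed points of `ρ`. -/
def contractGraph {V : Type*} (G : SimpleGraph V) (ρ : V → V) : SimpleGraph {v : V // ρ v = v} where
  Adj a b := a ≠ b ∧ ∃ u v, G.Adj u v ∧ ρ u = a ∧ ρ v = b
  symm := ⟨fun _ _ h => ⟨h.1.symm, by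
    obtain ⟨u, v, huv, hu, hv⟩ := h.2
    exact ⟨v, u, huv.symm, hv, hu⟩⟩⟩
  loopless := ⟨fun _ h => h.1 rfl⟩

/-- The contraction maps `ρ` used to halve a graph: every vertex is sent to a fixed point at
distance at most two, the fibres have at most three elements, and at most half of the vertices
are fixed. -/
structure IsContractionMap {V : Type*} (G : SimpleGraph V) (ρ : V → V) : Prop where
  idem : ∀ v, ρ (ρ v) = ρ v
  near : ∀ v, ∃ p : G.Walk v (ρ v), p.length ≤ 2
  fibre : ∀ v, (ρ ⁻¹' {v}).ncard ≤ 3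
  half : 2 * {v | ρ v = v}.ncard ≤ Nat.card V

/-- A matching with the maximum number of edges. -/
def IsMaximumMatching {V : Type*} (G : SimpleGraph V) (M : G.Subgraph) : Prop :=
  M.IsMatching ∧ ∀ M' : G.Subgraph, M'.IsMatching → M'.edgeSet.ncard ≤ M.edgeSet.ncard

/-! ## Random access machines

Programs manipulate natural-number variables and arrays; a program mentions only finitely many of
each. The operations are those of the usual unit-cost RAM with addition and subtraction
(and no multiplication), together with a write-only output. -/

/-- RAM programs. -/
inductive Ram where
  /-- `x := c` -/
  | const (x c : ℕ)
  /-- `x := y + z` -/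
  | add (x y z : ℕ)
  /-- `x := y - z`, and `x := 0` if `y < z` -/
  | sub (x y z : ℕ)
  /-- `x := a[y]` -/
  | read (x a y : ℕ)
  /-- `a[x] := y` -/
  | write (a x y : ℕ)
  /-- append the value of `x` to the output -/
  | emit (x : ℕ)
  /-- `p; q` -/
  | seq (p q : Ram)
  /-- `if x ≠ 0 then p else q` -/
  | cond (x : ℕ) (p q : Ram)
  /-- `while x ≠ 0 do p` -/
  | loop (x : ℕ) (p : Ram)

/-- A state of the machine: values of the variables, contents of the arrays, output so far. -/
structure RamState where
  var : ℕ → ℕ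
  arr : ℕ → ℕ → ℕ
  out : List ℕ

/-- `RamExec p s s' t`: started in the state `s`, the program `p` halts in the state `s'` after
exactly `t` steps. Every elementary instruction and every test is one step. -/
inductive RamExec : Ram → RamState → RamState → ℕ → Prop
  | const (x c : ℕ) (s : RamState) :
      RamExec (.const x c) s { s with var := Function.update s.var x c } 1
  | add (x y z : ℕ) (s : RamState) :
      RamExec (.add x y z) s { s with var := Function.update s.var x (s.var y + s.var z) } 1
  | sub (x y z : ℕ) (s : RamState) :
      RamExec (.sub x y z) s { s with var := Function.update s.var x (s.var y - s.var z) } 1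
  | read (x a y : ℕ) (s : RamState) :
      RamExec (.read x a y) s { s with var := Function.update s.var x (s.arr a (s.var y)) } 1
  | write (a x y : ℕ) (s : RamState) :
      RamExec (.write a x y) s
        { s with arr := Function.update s.arr a <|
          Function.update (s.arr a) (s.var x) (s.var y) } 1
  | emit (x : ℕ) (s : RamState) :
      RamExec (.emit x) s { s with out := s.out ++ [s.var x] } 1
  | seq {p q : Ram} {s₁ s₂ s₃ : RamState} {t u : ℕ} :
      RamExec p s₁ s₂ t → RamExec q s₂ s₃ u → RamExec (.seq p q) s₁ s₃ (t + u)
  | condTrue {x : ℕ} {p q : Ram} {s s' : RamState} {t : ℕ} :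
      s.var x ≠ 0 → RamExec p s s' t → RamExec (.cond x p q) s s' (t + 1)
  | condFalse {x : ℕ} {p q : Ram} {s s' : RamState} {t : ℕ} :
      s.var x = 0 → RamExec q s s' t → RamExec (.cond x p q) s s' (t + 1)
  | loopDone {x : ℕ} {p : Ram} {s : RamState} :
      s.var x = 0 → RamExec (.loop x p) s s 1
  | loopStep {x : ℕ} {p : Ram} {s₁ s₂ s₃ : RamState} {t u : ℕ} :
      s₁.var x ≠ 0 → RamExec p s₁ s₂ t → RamExec (.loop x p) s₂ s₃ u →
        RamExec (.loop x p) s₁ s₃ (t + u + 1)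

/-- The initial state on the input word `w`: array `0` holds `w`, variable `0` holds its length,
everything else is `0` and the output is empty. -/
def ramInput (w : List ℕ) : RamState where
  var x := if x = 0 then w.length else 0
  arr a i := if a = 0 then w.getD i 0 else 0
  out := []

/-- The length of a word of natural numbers when its entries are written in binary. -/
def bitLength (w : List ℕ) : ℕ := (w.map fun x => Nat.size x + 1).sum

/-- Some program, on each of the input words `inp a`, halts with output `out a` after a number of
steps that is polynomial in the bit length of `inp a`. -/
def PolyTime {A : Type*} (inp out : A → List ℕ) : Prop :=
  ∃ (p : Ram) (q : Polynomial ℕ), ∀ a, ∃ (s : RamState) (t : ℕ),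
    RamExec p (ramInput (inp a)) s t ∧ s.out = out a ∧ t ≤ q.eval (bitLength (inp a))

/-- Several words written as one: their number, then each word preceded by its length. -/
def packWords (ws : List (List ℕ)) : List ℕ :=
  ws.length :: ws.flatMap fun w => w.length :: w

/-! ## Minimization problems and reductions -/

/-- A minimization problem, with the encodings of its instances and solutions as words. -/
structure MinProblem where
  Instance : Type
  Solution : Instance → Type
  /-- the measure of the size of an instance -/
  size : Instance → ℕ
  /-- the measure of the quality of a solution -/
  cost : (I : Instance) → Solution I → ℕ
  instanceCode : Instance → List ℕ
  solutionCode : (I : Instance) → Solution I → List ℕ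

/-- The optimum cost of an instance. -/
def MinProblem.opt (P : MinProblem) (I : P.Instance) : ℕ := sInf (Set.range (P.cost I))

/-- A reducer and a merger. The reducer transforms an instance into a finite list of instances and
may compute additional information; the merger turns solutions of these instances into
a solution of the original one. -/
structure Reduction (P : MinProblem) where
  reduce : P.Instance → List P.Instance
  info : P.Instance → List ℕ
  merge : (I : P.Instance) →
    ((j : Fin (reduce I).length) → P.Solution ((reduce I).get j)) → P.Solution I

/-- The reducer and the merger run in polynomial time. The merger has access to the instance, to
the information computed by the reducer and to the solutions. -/
def Reduction.IsPolyTime {P : MinProblem} (R : Reduction P) : Prop :=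
  PolyTime (fun I => P.instanceCode I)
    (fun I => packWords (R.info I :: (R.reduce I).map P.instanceCode)) ∧
  PolyTime
    (A := Σ I : P.Instance,
      ((j : Fin (R.reduce I).length) → P.Solution ((R.reduce I).get j)))
    (fun x => packWords (P.instanceCode x.1 :: R.info x.1 ::
      List.ofFn fun j => P.solutionCode ((R.reduce x.1).get j) (x.2 j)))
    (fun x => P.solutionCode x.1 (R.merge x.1 x.2))

/-- `R` has rate `r`, with additive constant `c` in the sizes, and approximation `f`. -/
structure Reduction.HasRateApprox {P : MinProblem} (R : Reduction P) (r : ℝ) (f : ℝ → ℝ)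
    (c : ℝ) : Prop where
  size_le : ∀ I, ∀ J ∈ R.reduce I, (P.size J : ℝ) ≤ (P.size I : ℝ) / r + c
  cost_le : ∀ I (S : (j : Fin (R.reduce I).length) → P.Solution ((R.reduce I).get j)) (α : ℝ),
    1 ≤ α →
    (∀ j, (P.cost ((R.reduce I).get j) (S j) : ℝ) ≤ α * (P.opt ((R.reduce I).get j) : ℝ)) →
    (P.cost I (R.merge I S) : ℝ) ≤ f α * (P.opt I : ℝ)

/-! ## The Bandwidth problem -/

/-- A finite graph with vertices `0, …, n - 1`. -/
structure FinGraph where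
  n : ℕ
  graph : SimpleGraph (Fin n)

open scoped Classical in
/-- The number of vertices, followed by the rows of the adjacency matrix. -/
def FinGraph.code (G : FinGraph) : List ℕ :=
  G.n :: (List.finRange G.n).flatMap fun i =>
    (List.finRange G.n).map fun j => if G.graph.Adj i j then 1 else 0

/-- The Bandwidth problem: find an ordering of the vertices of minimum bandwidth. The size of an
instance is its number of vertices; an ordering is encoded as the list of its values. -/
def bandwidthProblem : MinProblem where
  Instance := FinGraph
  Solution G := VertexOrdering (Fin G.n)
  size G := G.n
  cost G f := orderingBandwidth G.graph f
  instanceCode G := G.code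
  solutionCode G f := (List.finRange G.n).map fun v => (f v : ℕ)

end

/-!
The first two parts rest on one observation about classes of vertices. Let the vertices of `G` be
ordered with bandwidth `b ≥ 1`, and let disjoint classes be contracted in each of which any two
vertices are within distance two, so that a class spans at most `2 * b` positions. Sort the classes
by their first positions. The first positions of two adjacent classes differ by at most
`b + 2 * b`; if they differ by exactly `3 * b`, then the endpoint of the joining edge in the lower
class lies strictly between them without being a first position. So the contracted graph has
bandwidth at most `3 * b - 1` (`graphBandwidth_quotient_lt`), whatever the classes are.

Hence it suffices to split the vertices that are not isolated into classes of two or three elements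
within distance two of each other. This is done in two steps. First the vertices are partitioned
into sets of at least two elements, pairwise within distance two; then each of these sets is cut, in
increasing order, into pairs and at most one triple (`IsRoot`, `groupLabel`). For a maximum matching,
the sets consist of a matching edge and the unmatched vertices attached to it; since there are no
augmenting paths of length one or three, any two elements of such a set are within distance two, and
numbering the matched vertices first keeps every matching edge together
(`exists_isContractionMap_of_isMaximumMatching`). For the algorithm no matching is needed: the sets
are the stars of a star partition which is built greedily, one vertex at a time
(`FinGraph.starStep`).

The reducer coarsens the graph `k` times and records for every vertex the label of its class. The
merger sorts the vertices by the positions of their classes. Classes have at most `3 ^ k` elements,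
so an ordering of cost `C` becomes one of cost at most `3 ^ k * C + 3 ^ k - 1`. As the coarsened
graph has bandwidth at most `3 ^ k * b - 1`, for `k ≥ 1`, the summand `- 1` makes up for the
additional term, and the approximation factor is `9 ^ k` (`FinGraph.mergeOrdering_cost_le`).

For the running times, a small language with expressions, simultaneous array assignments and loops
over `0, …, L - 1`, where `L` is the length of the input, is compiled to the random access machine
(`Prog.exists_runs_code`). Since all loops have the same bound, which no program can change, every
program of this language runs in polynomial time, and only its output has to be verified
(`polyTime_of_run`).
-/

noncomputable section

/-! ### Orderings given by keys -/

/-- The number of elements that a key function places strictly before `v`. -/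
def keyRank {V : Type*} (K : V → ℕ) (v : V) : ℕ := {w | K w < K v}.ncard

theorem keyRank_lt {V : Type*} [Finite V] (K : V → ℕ) (v : V) : keyRank K v < Nat.card V := by
  rw [← Set.ncard_univ]
  exact Set.ncard_lt_ncard ⟨Set.subset_univ _, fun h => (lt_irrefl (K v) (h (Set.mem_univ v)))⟩

theorem keyRank_add_ncard {V : Type*} [Finite V] (K : V → ℕ) {u v : V} (h : K u ≤ K v) :
    keyRank K v = keyRank K u + {w | K u ≤ K w ∧ K w < K v}.ncard := by
  unfold keyRank
  rw [← Set.ncard_union_eq]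
  · congr 1
    ext w
    simp only [Set.mem_ofPred_eq, Set.mem_union]
    omega
  · rw [Set.disjoint_left]
    intro w h1 h2
    simp only [Set.mem_ofPred_eq] at h1 h2
    omega

theorem keyRank_lt_iff {V : Type*} [Finite V] (K : V → ℕ) {u v : V} :
    keyRank K u < keyRank K v ↔ K u < K v := by
  have key : ∀ u v : V, K u < K v → keyRank K u < keyRank K v := fun u v h => by
    rw [keyRank_add_ncard K h.le]
    have : 0 < {w | K u ≤ K w ∧ K w < K v}.ncard :=
      (Set.ncard_pos).2 ⟨u, le_rfl, h⟩
    omega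
  refine ⟨fun h => ?_, key u v⟩
  by_contra hc
  rcases (not_lt.1 hc).lt_or_eq with h' | h'
  · exact absurd (key v u h') (by omega)
  · unfold keyRank at h
    rw [h'] at h
    exact lt_irrefl _ h

/-- The ordering that sorts the vertices by an injective key. -/
def keyOrdering {V : Type*} [Finite V] (K : V → ℕ) (hK : Function.Injective K) :
    VertexOrdering V :=
  Equiv.ofBijective (fun v => (⟨keyRank K v, keyRank_lt K v⟩ : Fin (Nat.card V))) <| by
    have hinj : Function.Injective
        fun v => (⟨keyRank K v, keyRank_lt K v⟩ : Fin (Nat.card V)) := by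
      intro u v h
      have h' : keyRank K u = keyRank K v := congrArg Fin.val h
      have h1 := keyRank_lt_iff K (u := u) (v := v)
      have h2 := keyRank_lt_iff K (u := v) (v := u)
      exact hK (by omega)
    exact hinj.bijective_of_nat_card_le (by simp)

theorem keyOrdering_val {V : Type*} [Finite V] (K : V → ℕ) (hK : Function.Injective K) (v : V) :
    (keyOrdering K hK v : ℕ) = keyRank K v := rfl

/-! ### Bandwidth of quotients -/

theorem dist_le_orderingBandwidth {V : Type*} (G : SimpleGraph V) (f : VertexOrdering V)
    {u v : V} (h : G.Adj u v) :
    Nat.dist (f u : ℕ) (f v : ℕ) ≤ orderingBandwidth G f := by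
  refine le_csSup ⟨Nat.card V, ?_⟩ ⟨u, v, h, rfl⟩
  rintro d ⟨u, v, -, rfl⟩
  have := (f u).2
  have := (f v).2
  unfold Nat.dist
  omega

theorem orderingBandwidth_le {V : Type*} (G : SimpleGraph V) {f : VertexOrdering V} {B : ℕ}
    (h : ∀ u v, G.Adj u v → (f u : ℕ) ≤ f v → (f v : ℕ) ≤ f u + B) :
    orderingBandwidth G f ≤ B := by
  refine csSup_le' ?_
  rintro d ⟨u, v, huv, rfl⟩
  rcases le_total (f u : ℕ) (f v) with h' | h'
  · have := h u v huv h'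
    unfold Nat.dist
    omega
  · have := h v u huv.symm h'
    unfold Nat.dist
    omega

theorem graphBandwidth_le {V : Type*} (G : SimpleGraph V) (f : VertexOrdering V) :
    graphBandwidth G ≤ orderingBandwidth G f :=
  Nat.sInf_le ⟨f, rfl⟩

theorem exists_orderingBandwidth_eq {V : Type*} [Finite V] (G : SimpleGraph V) :
    ∃ f : VertexOrdering V, orderingBandwidth G f = graphBandwidth G :=
  Nat.sInf_mem (s := Set.range fun f : VertexOrdering V => orderingBandwidth G f)
    ⟨_, Finite.equivFin V, rfl⟩

theorem one_le_graphBandwidth {V : Type*} [Finite V] (G : SimpleGraph V) {u v : V}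
    (h : G.Adj u v) : 1 ≤ graphBandwidth G := by
  obtain ⟨f, hf⟩ := exists_orderingBandwidth_eq G
  have h1 := dist_le_orderingBandwidth G f h
  have h2 : (f u : ℕ) ≠ f v := fun h' => h.ne (f.injective (Fin.ext h'))
  unfold Nat.dist at h1
  omega

/-- Two vertices are equal, adjacent, or have a common neighbour. -/
def WithinTwo {V : Type*} (G : SimpleGraph V) (u v : V) : Prop :=
  u = v ∨ G.Adj u v ∨ ∃ x, G.Adj u x ∧ G.Adj x v

theorem WithinTwo.symm {V : Type*} {G : SimpleGraph V} {u v : V} (h : WithinTwo G u v) :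
    WithinTwo G v u := by
  rcases h with rfl | h | ⟨x, h, h'⟩
  · exact .inl rfl
  · exact .inr (.inl h.symm)
  · exact .inr (.inr ⟨x, h'.symm, h.symm⟩)

theorem WithinTwo.exists_walk {V : Type*} {G : SimpleGraph V} {u v : V} (h : WithinTwo G u v) :
    ∃ p : G.Walk u v, p.length ≤ 2 := by
  rcases h with rfl | h | ⟨x, h, h'⟩
  · exact ⟨.nil, by simp⟩
  · exact ⟨.cons h .nil, by simp⟩
  · exact ⟨.cons h (.cons h' .nil), by simp⟩

theorem WithinTwo.le_add {V : Type*} (G : SimpleGraph V) (f : VertexOrdering V) {u v : V}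
    (h : WithinTwo G u v) :
    (f u : ℕ) ≤ f v + 2 * orderingBandwidth G f := by
  rcases h with rfl | h | ⟨x, h, h'⟩
  · omega
  · have := dist_le_orderingBandwidth G f h
    unfold Nat.dist at this
    omega
  · have h1 := dist_le_orderingBandwidth G f h
    have h2 := dist_le_orderingBandwidth G f h'
    unfold Nat.dist at h1 h2
    omega

/-- Contracting disjoint classes of diameter at most two turns bandwidth `b ≥ 1` into bandwidth at
most `3 * b - 1`. The classes are sorted by the first of their positions in an optimal ordering. -/
theorem graphBandwidth_quotient_lt {V : Type*} [Finite V] (G : SimpleGraph V)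
    {W : Type*} [Finite W] (H : SimpleGraph W) (cl : W → Set V)
    (hne : ∀ a, (cl a).Nonempty) (hdisj : ∀ a b v, v ∈ cl a → v ∈ cl b → a = b)
    (hnear : ∀ a, ∀ u ∈ cl a, ∀ v ∈ cl a, WithinTwo G u v)
    (hadj : ∀ a b, H.Adj a b → ∃ u ∈ cl a, ∃ v ∈ cl b, G.Adj u v)
    (hG : 1 ≤ graphBandwidth G) : graphBandwidth H + 1 ≤ 3 * graphBandwidth G := by
  obtain ⟨f, hf⟩ := exists_orderingBandwidth_eq G
  have hmin : ∀ a, ∃ r ∈ cl a, ∀ v ∈ cl a, (f r : ℕ) ≤ f v := fun a =>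
    Set.exists_min_image _ _ (Set.toFinite _) (hne a)
  choose r hr hrmin using hmin
  set K : W → ℕ := fun a => f (r a) with hKdef
  have hK : Function.Injective K := fun a b h => by
    have : r a = r b := f.injective (Fin.ext h)
    exact hdisj a b _ (hr a) (this ▸ hr b)
  have hB : orderingBandwidth H (keyOrdering K hK) ≤ 3 * graphBandwidth G - 1 := by
    refine orderingBandwidth_le H fun a b hab hle => ?_
    simp only [keyOrdering_val] at hle ⊢
    obtain ⟨u, hu, v, hv, huv⟩ := hadj a b hab
    have hKle : K a ≤ K b := by
      by_contra hc
      have := (keyRank_lt_iff K).2 (not_le.1 hc)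
      omega
    rw [keyRank_add_ncard K hKle]
    have h1 := (hnear a u hu (r a) (hr a)).le_add G f
    have h2 := dist_le_orderingBandwidth G f huv
    have h3 := hrmin b v hv
    have h4 := hrmin a u hu
    rw [hf] at h1 h2
    unfold Nat.dist at h2
    have hKb : K b ≤ f v := h3
    have hKa : K a ≤ f u := h4
    have hKa' : (f u : ℕ) ≤ K a + 2 * graphBandwidth G := h1
    -- Every class counted has its key in the interval `[K a, K b)`; if that interval has `3 * b`
    -- elements, then the position of `u` is one of them, and it is not the key of a class.
    suffices h : ∃ T : Finset ℕ, T.card ≤ 3 * graphBandwidth G - 1 ∧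
        ∀ w, K a ≤ K w → K w < K b → K w ∈ T by
      obtain ⟨T, hT, hm⟩ := h
      have : {w | K a ≤ K w ∧ K w < K b}.ncard ≤ T.card := by
        rw [← Set.ncard_coe_finset]
        refine Set.ncard_le_ncard_of_injOn K (fun w hw => hm w hw.1 hw.2) hK.injOn
          (Finset.finite_toSet T)
      omega
    by_cases hlt : K b - K a < 3 * graphBandwidth G
    · exact ⟨Finset.Ico (K a) (K b), by rw [Nat.card_Ico]; omega, fun w h h' =>
        Finset.mem_Ico.2 ⟨h, h'⟩⟩
    · refine ⟨(Finset.Ico (K a) (K b)).erase (f u), ?_, fun w h h' => ?_⟩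
      · rw [Finset.card_erase_of_mem (Finset.mem_Ico.2 ⟨by omega, by omega⟩), Nat.card_Ico]
        omega
      · refine Finset.mem_erase.2 ⟨fun heq => ?_, Finset.mem_Ico.2 ⟨h, h'⟩⟩
        have : r w = u := f.injective (Fin.ext heq)
        have : w = a := hdisj w a u (this ▸ hr w) hu
        subst this
        omega
  have := graphBandwidth_le H (keyOrdering K hK)
  omega

/-- Suppose that at most `s` vertices share a value of `key`, and that these values differ by at most
`C` along every edge. An ordering by a key `K` that refines `key` has bandwidth at most
`s * C + s - 1`: the vertices between the ends of an edge, one end included, miss at least one of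
the at most `s * (C + 1)` vertices whose values lie in the same range. -/
theorem orderingBandwidth_keyOrdering_le {V : Type*} [Finite V] (G : SimpleGraph V)
    {s C : ℕ} (K key : V → ℕ) (hK : Function.Injective K)
    (hlex : ∀ u v, K u < K v → key u ≤ key v)
    (hclass : ∀ x, {v | key v = x}.ncard ≤ s)
    (hadj : ∀ u v, G.Adj u v → key u ≤ key v + C) :
    orderingBandwidth G (keyOrdering K hK) ≤ s * C + s - 1 := by
  refine orderingBandwidth_le G fun u v huv hle => ?_
  simp only [keyOrdering_val] at hle ⊢
  have hKle : K u ≤ K v := by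
    by_contra hc
    have := (keyRank_lt_iff K).2 (not_le.1 hc)
    omega
  rw [keyRank_add_ncard K hKle]
  have h1 : {w | K u ≤ K w ∧ K w < K v} ⊂ ⋃ x ∈ Finset.Icc (key u) (key u + C),
      {v | key v = x} := by
    refine ⟨fun w hw => ?_, fun h => ?_⟩
    · have h1 := hlex w v hw.2
      have h2 : key u ≤ key w := by
        rcases hw.1.lt_or_eq with h | h
        · exact hlex _ _ h
        · rw [hK h]
      have h3 := hadj v u huv.symm
      simp only [Set.mem_iUnion, Set.mem_ofPred_eq, Finset.mem_Icc]
      exact ⟨_, ⟨h2, by omega⟩, rfl⟩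
    · have : v ∈ {w | K u ≤ K w ∧ K w < K v} := by
        apply h
        have h3 := hadj v u huv.symm
        have h2 : key u ≤ key v := by
          rcases hKle.lt_or_eq with h | h
          · exact hlex _ _ h
          · rw [hK h]
        simp only [Set.mem_iUnion, Set.mem_ofPred_eq, Finset.mem_Icc]
        exact ⟨_, ⟨h2, by omega⟩, rfl⟩
      exact lt_irrefl _ this.2
  have h2 := Set.ncard_lt_ncard h1 (Set.toFinite _)
  have h3 : (⋃ x ∈ Finset.Icc (key u) (key u + C), {v | key v = x}).ncard ≤ (C + 1) * s := by
    refine (Finset.set_ncard_biUnion_le _ _).trans ?_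
    refine (Finset.sum_le_card_nsmul _ _ s fun x _ => hclass x).trans ?_
    rw [Nat.card_Icc, smul_eq_mul]
    apply le_of_eq
    congr 1
    omega
  have : (C + 1) * s = s * C + s := by ring
  omega

/-! ### Splitting the fibres of a map into pairs and triples -/

theorem exists_mem_card_filter_lt_eq {T : Finset ℕ} {K : ℕ → ℕ} (hK : Set.InjOn K T) {j : ℕ}
    (hj : j < T.card) : ∃ v ∈ T, (T.filter fun u => K u < K v).card = j := by
  have hlt : ∀ u ∈ T, ∀ v ∈ T, K u < K v →
      (T.filter fun w => K w < K u).card < (T.filter fun w => K w < K v).card := by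
    intro u hu v hv h
    refine Finset.card_lt_card ⟨fun w hw => ?_, fun hs => ?_⟩
    · simp only [Finset.mem_filter] at hw ⊢
      exact ⟨hw.1, hw.2.trans h⟩
    · have := hs (Finset.mem_filter.2 ⟨hu, h⟩)
      simp at this
  have himg : T.image (fun v => (T.filter fun u => K u < K v).card) = Finset.range T.card := by
    refine Finset.eq_of_subset_of_card_le (fun x hx => ?_) ?_
    · obtain ⟨v, hv, rfl⟩ := Finset.mem_image.1 hx
      refine Finset.mem_range.2 (Finset.card_lt_card ⟨Finset.filter_subset _ _, fun hs => ?_⟩)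
      have := hs hv
      simp at this
    · rw [Finset.card_range, Finset.card_image_of_injOn]
      intro u hu v hv h
      refine hK hu hv ?_
      rcases lt_trichotomy (K u) (K v) with h' | h' | h'
      · exact absurd h (hlt u hu v hv h').ne
      · exact h'
      · exact absurd h (hlt v hv u hu h').ne'
  have := Finset.mem_range.2 hj
  rw [← himg] at this
  obtain ⟨v, hv, h⟩ := Finset.mem_image.1 this
  exact ⟨v, hv, h⟩

section Pairing

open scoped Classical in
/-- The number of elements below `n` in the fibre of `v`. -/
def fibreCard (n : ℕ) (p : ℕ → ℕ) (v : ℕ) : ℕ := ((Finset.range n).filter fun u => p u = p v).card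

open scoped Classical in
/-- The number of elements of the fibre of `v` that are smaller than `v`. -/
def fibreRank (n : ℕ) (p : ℕ → ℕ) (v : ℕ) : ℕ :=
  ((Finset.range n).filter fun u => u < v ∧ p u = p v).card

/-- The elements of a fibre are grouped in increasing order into pairs, the last three elements of
a fibre of odd size forming a triple. A root is the first element of its group. A fibre with only
one element has no root. -/
def IsRoot (n : ℕ) (p : ℕ → ℕ) (v : ℕ) : Prop :=
  Even (fibreRank n p v) ∧ fibreRank n p v + 1 < fibreCard n p v

open scoped Classical in
/-- The number of groups. -/
def numGroups (n : ℕ) (p : ℕ → ℕ) : ℕ := ((Finset.range n).filter (IsRoot n p)).card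

open scoped Classical in
/-- The number of roots up to `v` when elements are sorted first by fibre and then by size. The
groups are intervals in this order, so this number identifies the group of `v`. -/
def rootCount (n : ℕ) (p : ℕ → ℕ) (v : ℕ) : ℕ :=
  ((Finset.range n).filter fun r => IsRoot n p r ∧ (p r < p v ∨ p r = p v ∧ r ≤ v)).card

/-- The groups are numbered from zero. -/
def groupLabel (n : ℕ) (p : ℕ → ℕ) (v : ℕ) : ℕ := rootCount n p v - 1

variable {n : ℕ} {p : ℕ → ℕ}

theorem fibreCard_congr {u v : ℕ} (h : p u = p v) : fibreCard n p u = fibreCard n p v := by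
  unfold fibreCard
  rw [h]

theorem fibreRank_eq {v : ℕ} : fibreRank n p v =
    (((Finset.range n).filter fun u => p u = p v).filter fun u => id u < id v).card := by
  unfold fibreRank
  rw [Finset.filter_filter]
  congr 1
  ext
  simp [and_comm]

theorem fibreRank_lt_fibreRank {u v : ℕ} (hu : u < n) (h : u < v) (hp : p u = p v) :
    fibreRank n p u < fibreRank n p v := by
  refine Finset.card_lt_card ⟨fun w hw => ?_, fun hs => ?_⟩
  · simp only [Finset.mem_filter] at hw ⊢
    exact ⟨hw.1, hw.2.1.trans h, hw.2.2.trans hp⟩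
  · have := hs (Finset.mem_filter.2 ⟨Finset.mem_range.2 hu, h, hp⟩)
    simp at this

theorem lt_of_fibreRank_lt {u v : ℕ} (hv : v < n) (hp : p u = p v)
    (h : fibreRank n p u < fibreRank n p v) : u < v := by
  rcases lt_trichotomy u v with h' | rfl | h'
  · exact h'
  · exact absurd h (lt_irrefl _)
  · exact absurd h (fibreRank_lt_fibreRank hv h' hp.symm).le.not_gt

theorem eq_of_fibreRank_eq {u v : ℕ} (hu : u < n) (hv : v < n) (hp : p u = p v)
    (h : fibreRank n p u = fibreRank n p v) : u = v := by
  rcases lt_trichotomy u v with h' | rfl | h'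
  · exact absurd h (fibreRank_lt_fibreRank hu h' hp).ne
  · rfl
  · exact absurd h (fibreRank_lt_fibreRank hv h' hp.symm).ne'

theorem fibreRank_lt_fibreCard {v : ℕ} (hv : v < n) : fibreRank n p v < fibreCard n p v := by
  refine Finset.card_lt_card ⟨fun w hw => ?_, fun hs => ?_⟩
  · simp only [Finset.mem_filter] at hw ⊢
    exact ⟨hw.1, hw.2.2⟩
  · have := hs (Finset.mem_filter.2 ⟨Finset.mem_range.2 hv, rfl⟩)
    simp at this

theorem exists_fibreRank_eq {v j : ℕ} (hj : j < fibreCard n p v) :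
    ∃ u < n, p u = p v ∧ fibreRank n p u = j := by
  obtain ⟨u, hu, h⟩ := exists_mem_card_filter_lt_eq (K := id) Function.injective_id.injOn hj
  rw [Finset.mem_filter, Finset.mem_range] at hu
  refine ⟨u, hu.1, hu.2, ?_⟩
  rw [fibreRank_eq, hu.2]
  exact h

/-- Sorting by this key is sorting by fibre and then by size. -/
theorem fibreKey_le_iff {r v : ℕ} (hr : r < n) (hv : v < n) :
    p r * n + r ≤ p v * n + v ↔ p r < p v ∨ p r = p v ∧ r ≤ v := by
  rcases lt_trichotomy (p r) (p v) with h | h | h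
  · have : (p r + 1) * n ≤ p v * n := Nat.mul_le_mul_right _ h
    rw [add_mul] at this
    simp only [h, true_or, iff_true]
    omega
  · simp [h]
  · have : (p v + 1) * n ≤ p r * n := Nat.mul_le_mul_right _ h
    rw [add_mul] at this
    have h2 : ¬(p r < p v ∨ p r = p v ∧ r ≤ v) := by omega
    simp only [h2, iff_false]
    omega

theorem rootCount_eq {v : ℕ} (hv : v < n) [DecidablePred (IsRoot n p)] : rootCount n p v =
    (((Finset.range n).filter (IsRoot n p)).filter
      fun r => p r * n + r ≤ p v * n + v).card := by
  unfold rootCount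
  rw [Finset.filter_filter]
  congr 1
  ext r
  simp only [Finset.mem_filter, Finset.mem_range]
  constructor
  · rintro ⟨h, h1, h2⟩
    exact ⟨h, h1, (fibreKey_le_iff h hv).2 h2⟩
  · rintro ⟨h, h1, h2⟩
    exact ⟨h, h1, (fibreKey_le_iff h hv).1 h2⟩

theorem rootCount_lt_rootCount {u v r : ℕ} (hu : u < n) (hv : v < n) (hrn : r < n)
    (hr : IsRoot n p r) (h1 : p u * n + u < p r * n + r) (h2 : p r * n + r ≤ p v * n + v) :
    rootCount n p u < rootCount n p v := by
  classical
  rw [rootCount_eq hu, rootCount_eq hv]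
  refine Finset.card_lt_card ⟨fun w hw => ?_, fun hs => ?_⟩
  · simp only [Finset.mem_filter] at hw ⊢
    exact ⟨hw.1, by omega⟩
  · have := hs (Finset.mem_filter.2 ⟨Finset.mem_filter.2 ⟨Finset.mem_range.2 hrn, hr⟩, h2⟩)
    simp only [Finset.mem_filter] at this
    omega

theorem one_le_rootCount {v : ℕ} (hv : v < n) (h2 : 2 ≤ fibreCard n p v) :
    1 ≤ rootCount n p v := by
  classical
  obtain ⟨r, hr, hp, h0⟩ := exists_fibreRank_eq (v := v) (n := n) (p := p) (j := 0) (by omega)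
  refine Finset.card_pos.2 ⟨r, Finset.mem_filter.2 ⟨Finset.mem_range.2 hr, ⟨?_, ?_⟩, ?_⟩⟩
  · simp [h0]
  · rw [h0, fibreCard_congr hp]
    omega
  · refine .inr ⟨hp, ?_⟩
    by_contra hc
    have := fibreRank_lt_fibreRank hv (not_le.1 hc) hp.symm
    omega

theorem rootCount_eq_of_fibreRank_succ {u v : ℕ} (hu : u < n) (hv : v < n) (hp : p u = p v)
    (h : fibreRank n p v = fibreRank n p u + 1) (hr : ¬ IsRoot n p v) :
    rootCount n p u = rootCount n p v := by
  classical
  rw [rootCount_eq hu, rootCount_eq hv]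
  congr 1
  ext r
  simp only [Finset.mem_filter, Finset.mem_range]
  refine and_congr_right fun hrr => ?_
  rw [fibreKey_le_iff hrr.1 hu, fibreKey_le_iff hrr.1 hv, hp]
  have huv : u < v := lt_of_fibreRank_lt hv hp (by omega)
  refine or_congr_right (and_congr_right fun hpr => ⟨fun h => by omega, fun hle => ?_⟩)
  by_contra hc
  have h1 := fibreRank_lt_fibreRank hu (not_le.1 hc) (hp.trans hpr.symm)
  have h2 : r ≠ v := fun h => hr (h ▸ hrr.2)
  have h3 := fibreRank_lt_fibreRank hrr.1 (lt_of_le_of_ne hle h2) hpr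
  omega

/-- Groups lie within fibres. -/
theorem eq_of_rootCount_eq {u v : ℕ} (hu : u < n) (hv : v < n) (hu2 : 2 ≤ fibreCard n p u)
    (hv2 : 2 ≤ fibreCard n p v) (h : rootCount n p u = rootCount n p v) : p u = p v := by
  have key : ∀ u v : ℕ, u < n → v < n → 2 ≤ fibreCard n p v →
      rootCount n p u = rootCount n p v → ¬ p u < p v := by
    intro u v hu hv hv2 h hlt
    obtain ⟨r, hr, hp, h0⟩ := exists_fibreRank_eq (v := v) (n := n) (p := p) (j := 0) (by omega)
    have hroot : IsRoot n p r := ⟨by simp [h0], by rw [h0, fibreCard_congr hp]; omega⟩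
    refine absurd h (rootCount_lt_rootCount hu hv hr hroot ?_ ?_).ne
    · rw [← not_le, fibreKey_le_iff hr hu]
      omega
    · rw [fibreKey_le_iff hr hv]
      refine .inr ⟨hp, ?_⟩
      by_contra hc
      have := fibreRank_lt_fibreRank hv (not_le.1 hc) hp.symm
      omega
  have h1 := key u v hu hv hv2 h
  have h2 := key v u hv hu hu2 h.symm
  omega

theorem fibreRank_le_add_two {u v : ℕ} (hu : u < n) (hv : v < n) (hp : p u = p v)
    (h : rootCount n p u = rootCount n p v) : fibreRank n p v ≤ fibreRank n p u + 2 := by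
  by_contra hc
  have hlt := fibreRank_lt_fibreCard (p := p) hv
  -- One of the next two elements after `u` has even rank and is a root.
  obtain ⟨j, hj, hj1, hj2⟩ : ∃ j, Even j ∧ fibreRank n p u < j ∧ j ≤ fibreRank n p u + 2 := by
    rcases Nat.even_or_odd (fibreRank n p u) with h | h
    · exact ⟨_, h.add even_two, by omega, le_rfl⟩
    · exact ⟨_, h.add_one, by omega, by omega⟩
  obtain ⟨r, hr, hpr, hrj⟩ := exists_fibreRank_eq (v := v) (n := n) (p := p) (j := j) (by omega)
  have hroot : IsRoot n p r := ⟨hrj ▸ hj, by rw [fibreCard_congr hpr]; omega⟩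
  have h1 : u < r := lt_of_fibreRank_lt hr (hp.trans hpr.symm) (by omega)
  have h2 : r < v := lt_of_fibreRank_lt hv hpr (by omega)
  refine absurd h (rootCount_lt_rootCount hu hv hr hroot ?_ ?_).ne
  · rw [hp, hpr]
    omega
  · rw [hpr]
    omega

theorem exists_ne_rootCount_eq {v : ℕ} (hv : v < n) (h2 : 2 ≤ fibreCard n p v) :
    ∃ u < n, u ≠ v ∧ p u = p v ∧ rootCount n p u = rootCount n p v := by
  have hlt := fibreRank_lt_fibreCard (p := p) hv
  by_cases hroot : IsRoot n p v
  · obtain ⟨u, hu, hp, hj⟩ := exists_fibreRank_eq (v := v) (n := n) (p := p)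
      (j := fibreRank n p v + 1) hroot.2
    refine ⟨u, hu, fun h => by subst h; omega, hp, ?_⟩
    refine (rootCount_eq_of_fibreRank_succ hv hu hp.symm hj fun hr => ?_).symm
    have h1 := hr.1
    rw [hj, Nat.even_add_one] at h1
    exact h1 hroot.1
  · have h0 : 1 ≤ fibreRank n p v := by
      by_contra hc
      have h0 : fibreRank n p v = 0 := by omega
      exact hroot ⟨by simp [h0], by omega⟩
    obtain ⟨u, hu, hp, hj⟩ := exists_fibreRank_eq (v := v) (n := n) (p := p)
      (j := fibreRank n p v - 1) (by omega)
    exact ⟨u, hu, fun h => by subst h; omega, hp,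
      rootCount_eq_of_fibreRank_succ hu hv hp (by omega) hroot⟩

theorem rootCount_le_numGroups {v : ℕ} : rootCount n p v ≤ numGroups n p := by
  refine Finset.card_le_card fun w hw => ?_
  simp only [Finset.mem_filter] at hw ⊢
  exact ⟨hw.1, hw.2.1⟩

theorem groupLabel_lt {v : ℕ} (hv : v < n) (h2 : 2 ≤ fibreCard n p v) :
    groupLabel n p v < numGroups n p := by
  have h1 := one_le_rootCount hv h2
  have h3 := rootCount_le_numGroups (n := n) (p := p) (v := v)
  unfold groupLabel
  omega

theorem rootCount_eq_of_groupLabel_eq {u v : ℕ} (hu : u < n) (hv : v < n)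
    (hu2 : 2 ≤ fibreCard n p u) (hv2 : 2 ≤ fibreCard n p v)
    (h : groupLabel n p u = groupLabel n p v) : rootCount n p u = rootCount n p v := by
  have h1 := one_le_rootCount hu hu2
  have h2 := one_le_rootCount hv hv2
  unfold groupLabel at h
  omega

theorem exists_groupLabel_eq {j : ℕ} (hj : j < numGroups n p) :
    ∃ v < n, 2 ≤ fibreCard n p v ∧ groupLabel n p v = j := by
  classical
  have hinj : Set.InjOn (fun r => p r * n + r) ((Finset.range n).filter (IsRoot n p)) := by
    intro u hu v hv h
    simp only [Finset.coe_filter, Finset.mem_range, Set.mem_ofPred_eq] at hu hv h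
    have h1 := (fibreKey_le_iff (p := p) hu.1 hv.1).1 h.le
    have h2 := (fibreKey_le_iff (p := p) hv.1 hu.1).1 h.ge
    omega
  obtain ⟨v, hv, h⟩ := exists_mem_card_filter_lt_eq hinj (j := j) (by
    unfold numGroups at hj
    convert hj)
  have hv' := hv
  rw [Finset.mem_filter, Finset.mem_range] at hv'
  refine ⟨v, hv'.1, ?_, ?_⟩
  · have := hv'.2.2
    omega
  · unfold groupLabel
    rw [rootCount_eq hv'.1, ← h]
    have : ((Finset.range n).filter (IsRoot n p)).filter
        (fun r => p r * n + r ≤ p v * n + v) = insert v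
        (((Finset.range n).filter (IsRoot n p)).filter fun r => p r * n + r < p v * n + v) := by
      ext r
      simp only [Finset.mem_insert, Finset.mem_filter, Finset.mem_range]
      constructor
      · rintro ⟨hr, hle⟩
        rcases hle.lt_or_eq with h | h
        · exact .inr ⟨hr, h⟩
        · exact .inl (hinj (Finset.mem_coe.2 (Finset.mem_filter.2
            ⟨Finset.mem_range.2 hr.1, hr.2⟩)) hv h)
      · rintro (rfl | ⟨hr, hlt⟩)
        · exact ⟨hv', le_rfl⟩
        · exact ⟨hr, hlt.le⟩
    rw [this, Finset.card_insert_of_notMem (by simp)]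
    rfl

/-- A group has at most three elements. -/
theorem card_groupLabel_le_three {T : Finset ℕ} {j : ℕ}
    (hT : ∀ v ∈ T, v < n ∧ 2 ≤ fibreCard n p v ∧ groupLabel n p v = j) : T.card ≤ 3 := by
  rcases T.eq_empty_or_nonempty with rfl | hne
  · simp
  obtain ⟨u, hu, hmin⟩ := Finset.exists_min_image T (fibreRank n p) hne
  have hrc : ∀ v ∈ T, ∀ w ∈ T, rootCount n p v = rootCount n p w := fun v hv w hw =>
    rootCount_eq_of_groupLabel_eq (hT v hv).1 (hT w hw).1 (hT v hv).2.1 (hT w hw).2.1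
      ((hT v hv).2.2.trans (hT w hw).2.2.symm)
  have hp : ∀ v ∈ T, ∀ w ∈ T, p v = p w := fun v hv w hw =>
    eq_of_rootCount_eq (hT v hv).1 (hT w hw).1 (hT v hv).2.1 (hT w hw).2.1 (hrc v hv w hw)
  have : T.card ≤ (Finset.Icc (fibreRank n p u) (fibreRank n p u + 2)).card := by
    refine Finset.card_le_card_of_injOn (fibreRank n p) (fun v hv => ?_) fun v hv w hw h =>
      eq_of_fibreRank_eq (hT v hv).1 (hT w hw).1 (hp v hv w hw) h
    exact Finset.mem_coe.2 (Finset.mem_Icc.2 ⟨hmin v hv,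
      fibreRank_le_add_two (hT u hu).1 (hT v hv).1 (hp u hu v hv) (hrc u hu v hv)⟩)
  rw [Nat.card_Icc] at this
  omega

end Pairing

/-! ### Contraction maps from labellings -/

/-- A labelling whose fibres have two or three elements, pairwise within distance two, together with
a choice of representatives, gives a contraction map. -/
theorem isContractionMap_of_labelling {V W : Type*} [Finite V] {G : SimpleGraph V} {c : V → W}
    {rep : W → V} (hrep : ∀ a, c (rep a) = a) (hnear : ∀ u v, c u = c v → WithinTwo G u v)
    (h2 : ∀ v, ∃ u, u ≠ v ∧ c u = c v)
    (h3 : ∀ (T : Finset V) (a : W), (∀ v ∈ T, c v = a) → T.card ≤ 3) :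
    IsContractionMap G fun v => rep (c v) where
  idem v := by rw [hrep]
  near v := (hnear v _ (hrep _).symm).exists_walk
  fibre v := by
    rw [Set.ncard_eq_toFinset_card _ (Set.toFinite _)]
    refine h3 _ (c v) fun u hu => ?_
    have hu' : rep (c u) = v := by simpa using hu
    rw [← hu', hrep]
  half := by
    choose g hg hgc using h2
    have hinj : Set.InjOn g {v | rep (c v) = v} := fun u hu v hv h => by
      have : c u = c v := by rw [← hgc u, ← hgc v, h]
      rw [← show rep (c u) = u from hu, ← show rep (c v) = v from hv, this]
    have hdisj : Disjoint {v | rep (c v) = v} (g '' {v | rep (c v) = v}) := by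
      rw [Set.disjoint_left]
      rintro _ hu ⟨v, hv, rfl⟩
      refine hg v ?_
      rw [← show rep (c (g v)) = g v from hu, hgc]
      exact hv
    rw [two_mul, ← Set.ncard_univ]
    nth_rw 2 [← hinj.ncard_image]
    rw [← Set.ncard_union_eq hdisj]
    exact Set.ncard_le_ncard (Set.subset_univ _)

/-- The contracted graph is the quotient by the labelling. -/
theorem nonempty_iso_contractGraph {V W : Type*} {G : SimpleGraph V} {c : V → W}
    {rep : W → V} (hrep : ∀ a, c (rep a) = a) {H : SimpleGraph W}
    (hH : ∀ a b, H.Adj a b ↔ a ≠ b ∧ ∃ u v, G.Adj u v ∧ c u = a ∧ c v = b) :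
    Nonempty (H ≃g contractGraph G fun v => rep (c v)) := by
  have hinj : Function.Injective rep := fun a b h => by rw [← hrep a, h, hrep]
  refine ⟨⟨⟨fun a => ⟨rep a, by rw [hrep]⟩, fun v => c v, fun a => hrep a, fun v =>
    Subtype.ext v.2⟩, ?_⟩⟩
  intro a b
  simp only [contractGraph, Equiv.coe_fn_mk, hH, ne_eq, Subtype.mk.injEq, hinj.eq_iff]

/-! ### Maximum matchings -/

section Matching

variable {V : Type*} {G : SimpleGraph V}

theorem isMatching_sup_edge {M : G.Subgraph} (hM : M.IsMatching) {u v : V} (h : G.Adj u v)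
    (hu : u ∉ M.verts) (hv : v ∉ M.verts) : (M ⊔ G.subgraphOfAdj h).IsMatching := by
  refine hM.sup (.subgraphOfAdj h) ?_
  rw [hM.support_eq_verts, (SimpleGraph.Subgraph.IsMatching.subgraphOfAdj h).support_eq_verts,
    Set.disjoint_right]
  rintro x (rfl | rfl)
  · exact hu
  · exact hv

theorem ncard_edgeSet_sup_edge [Finite V] {M : G.Subgraph} {u v : V} (h : G.Adj u v)
    (hu : u ∉ M.verts) : (M ⊔ G.subgraphOfAdj h).edgeSet.ncard = M.edgeSet.ncard + 1 := by
  rw [SimpleGraph.Subgraph.edgeSet_sup, SimpleGraph.edgeSet_subgraphOfAdj, Set.union_singleton]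
  refine Set.ncard_insert_of_notMem (fun hmem => hu ?_) (Set.toFinite _)
  exact M.edge_vert (SimpleGraph.Subgraph.mem_edgeSet.1 hmem)

theorem IsMaximumMatching.not_adj [Finite V] {M : G.Subgraph} (hM : IsMaximumMatching G M)
    {u v : V} (hu : u ∉ M.verts) (hv : v ∉ M.verts) : ¬ G.Adj u v := fun h => by
  have := hM.2 _ (isMatching_sup_edge hM.1 h hu hv)
  rw [ncard_edgeSet_sup_edge h hu] at this
  omega

/-- A maximum matching has no augmenting path of length three. -/
theorem IsMaximumMatching.eq_of_adj [Finite V] {M : G.Subgraph} (hM : IsMaximumMatching G M)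
    {u v x y : V} (hu : u ∉ M.verts) (hv : v ∉ M.verts) (hxy : M.Adj x y) (hux : G.Adj u x)
    (hvy : G.Adj v y) : u = v := by
  by_contra hne
  set N := M.deleteVerts {x, y} with hN
  have hNle : N ≤ M := SimpleGraph.Subgraph.deleteVerts_le
  have hNM : N.IsMatching := by
    intro a ha
    rw [hN, SimpleGraph.Subgraph.deleteVerts_verts] at ha
    obtain ⟨b, hb, hb'⟩ := hM.1 ha.1
    refine ⟨b, ?_, fun z hz => hb' z (hNle.2 hz)⟩
    refine SimpleGraph.Subgraph.deleteVerts_adj.2 ⟨ha.1, ha.2, M.edge_vert hb.symm, ?_, hb⟩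
    rintro (rfl | rfl)
    · exact ha.2 (.inr (hM.1.eq_of_adj_left hb.symm hxy))
    · exact ha.2 (.inl (hM.1.eq_of_adj_left hb.symm hxy.symm))
  have huN : u ∉ N.verts := fun h => hu (hNle.1 h)
  have hvN : v ∉ N.verts := fun h => hv (hNle.1 h)
  have hxN : x ∉ N.verts := by
    rw [hN, SimpleGraph.Subgraph.deleteVerts_verts]
    simp
  have hyN : y ∉ N.verts := by
    rw [hN, SimpleGraph.Subgraph.deleteVerts_verts]
    simp
  have h1 := isMatching_sup_edge hNM hux huN hxN
  have hverts : ∀ z, z ∉ N.verts → z ≠ u → z ≠ x → z ∉ (N ⊔ G.subgraphOfAdj hux).verts := by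
    intro z h1 h2 h3
    simp [h1, h2, h3]
  have hv2 := hverts v hvN (Ne.symm hne) (fun h => hv (h ▸ M.edge_vert hxy))
  have hy2 := hverts y hyN (fun h => hu (h ▸ M.edge_vert hxy.symm)) (M.adj_sub hxy).ne'
  have h2 := hM.2 _ (isMatching_sup_edge h1 hvy hv2 hy2)
  rw [ncard_edgeSet_sup_edge hvy hv2, ncard_edgeSet_sup_edge hux huN] at h2
  have h3 : M.edgeSet ⊆ insert s(x, y) N.edgeSet := by
    intro ed
    induction ed with | _ a b =>
    intro hab
    rw [SimpleGraph.Subgraph.mem_edgeSet] at hab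
    by_cases hax : a = x
    · subst hax
      rw [hM.1.eq_of_adj_left hab hxy]
      exact Set.mem_insert _ _
    by_cases hay : a = y
    · subst hay
      rw [hM.1.eq_of_adj_left hab hxy.symm, Sym2.eq_swap]
      exact Set.mem_insert _ _
    by_cases hbx : b = x
    · subst hbx
      rw [hM.1.eq_of_adj_left hab.symm hxy, Sym2.eq_swap]
      exact Set.mem_insert _ _
    by_cases hby : b = y
    · subst hby
      rw [hM.1.eq_of_adj_left hab.symm hxy.symm]
      exact Set.mem_insert _ _
    refine .inr (SimpleGraph.Subgraph.deleteVerts_adj.2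
      ⟨M.edge_vert hab, ?_, M.edge_vert hab.symm, ?_, hab⟩) <;> simp [*]
  have h4 := Set.ncard_le_ncard h3 (Set.toFinite _)
  have h5 := Set.ncard_insert_le s(x, y) N.edgeSet
  omega

/-- The classes around the edges of a maximum matching: an unmatched vertex joins the edge of one of
its neighbours. Numbering the matched vertices first makes every matching edge the first pair of
its class. -/
theorem exists_isContractionMap_of_isMaximumMatching [Finite V] (hG : ∀ v, ∃ w, G.Adj v w)
    (hb : 1 ≤ graphBandwidth G) {M : G.Subgraph} (hM : IsMaximumMatching G M) :
    ∃ ρ : V → V, IsContractionMap G ρ ∧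
      (∀ u w, M.Adj u w → (ρ u = u ∧ ρ w = u) ∨ (ρ u = w ∧ ρ w = w)) ∧
      graphBandwidth (contractGraph G ρ) + 1 ≤ 3 * graphBandwidth G := by
  classical
  choose nb hnb using hG
  have hmate : ∀ v, ∃ w, v ∈ M.verts → M.Adj v w := fun v => by
    by_cases h : v ∈ M.verts
    · obtain ⟨w, hw, -⟩ := hM.1 h
      exact ⟨w, fun _ => hw⟩
    · exact ⟨v, fun h' => absurd h' h⟩
  choose mate hmate using hmate
  have hmate_eq : ∀ {u w}, M.Adj u w → mate u = w := fun h =>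
    hM.1.eq_of_adj_left (hmate _ (M.edge_vert h)) h
  have hnbM : ∀ v, v ∉ M.verts → nb v ∈ M.verts := fun v hv => by
    by_contra hc
    exact hM.not_adj hv hc (hnb v)
  set n := Nat.card V
  set ed : V → Sym2 V := fun v =>
    if v ∈ M.verts then s(v, mate v) else s(nb v, mate (nb v)) with hed
  have hedm : ∀ {v}, v ∈ M.verts → ed v = s(v, mate v) := fun h => if_pos h
  have hedu : ∀ {v}, v ∉ M.verts → ed v = s(nb v, mate (nb v)) := fun h => if_neg h
  have hed_adj : ∀ {u w}, M.Adj u w → ed u = ed w := fun {u w} h => by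
    rw [hedm (M.edge_vert h), hedm (M.edge_vert h.symm), hmate_eq h, hmate_eq h.symm,
      Sym2.eq_swap]
  have hed_nb : ∀ {v}, v ∉ M.verts → ed (nb v) = ed v := fun {v} h => by
    rw [hedm (hnbM v h), hedu h]
  have hed_matched : ∀ {u v}, u ∈ M.verts → v ∈ M.verts → ed u = ed v → u = v ∨ M.Adj v u := by
    intro u v hu hv h
    rw [hedm hu, hedm hv, Sym2.eq_iff] at h
    rcases h with h | h
    · exact .inl h.1
    · exact .inr (h.1 ▸ hmate v hv)
  have hnear1 : ∀ {u v}, u ∉ M.verts → v ∈ M.verts → ed u = ed v → WithinTwo G u v := by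
    intro u v hu hv h
    rw [← hed_nb hu] at h
    rcases hed_matched (hnbM u hu) hv h with h | h
    · exact .inr (.inl (h ▸ hnb u))
    · exact .inr (.inr ⟨nb u, hnb u, (M.adj_sub h).symm⟩)
  have hnear : ∀ u v, ed u = ed v → WithinTwo G u v := by
    intro u v h
    by_cases hu : u ∈ M.verts <;> by_cases hv : v ∈ M.verts
    · rcases hed_matched hu hv h with h | h
      · exact .inl h
      · exact .inr (.inl (M.adj_sub h.symm))
    · exact (hnear1 hv hu h.symm).symm
    · exact hnear1 hu hv h
    · rw [← hed_nb hu, ← hed_nb hv] at h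
      rcases hed_matched (hnbM u hu) (hnbM v hv) h with h | h
      · exact .inr (.inr ⟨nb u, hnb u, h ▸ (hnb v).symm⟩)
      · exact .inl (hM.eq_of_adj hu hv h.symm (hnb u) (hnb v))
  -- The matched vertices come first.
  set K : V → ℕ := fun v => (Finite.equivFin V v : ℕ) + if v ∈ M.verts then 0 else n with hKdef
  have hKM : ∀ {u v}, K u < K v → v ∈ M.verts → u ∈ M.verts := by
    intro u v h hv
    by_contra hu
    have := (Finite.equivFin V v).2
    simp only [hKdef, hv, hu, if_true, if_false] at h
    omega
  have hK : Function.Injective K := by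
    intro u v h
    have h1 := (Finite.equivFin V v).2
    have h2 := (Finite.equivFin V u).2
    refine (Finite.equivFin V).injective (Fin.ext ?_)
    simp only [hKdef] at h
    split_ifs at h <;> omega
  set e : V → ℕ := fun v => keyOrdering K hK v with he
  have hen : ∀ v, e v < n := fun v => (keyOrdering K hK v).2
  have helt : ∀ {u v}, e u < e v ↔ K u < K v := keyRank_lt_iff K
  have hes : ∀ i < n, ∃ v, e v = i := fun i hi =>
    ⟨(keyOrdering K hK).symm ⟨i, hi⟩, by simp [he]⟩
  have heinj : Function.Injective e := fun u v h => (keyOrdering K hK).injective (Fin.ext h)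
  set p : ℕ → ℕ := fun i =>
    if h : i < n then Finite.equivFin (Sym2 V) (ed ((keyOrdering K hK).symm ⟨i, h⟩)) else 0 with hp
  have hpe : ∀ {u v}, p (e u) = p (e v) ↔ ed u = ed v := by
    have : ∀ v, p (e v) = Finite.equivFin (Sym2 V) (ed v) := fun v => by
      simp only [hp, hen v, dif_pos]
      simp [he]
    intro u v
    rw [this, this, Fin.val_inj, (Finite.equivFin (Sym2 V)).injective.eq_iff]
  have hcard : ∀ v, 2 ≤ fibreCard n p (e v) := by
    have hex : ∀ v, ∃ u, u ≠ v ∧ ed u = ed v := by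
      intro v
      by_cases hv : v ∈ M.verts
      · exact ⟨mate v, (M.adj_sub (hmate v hv)).ne', (hed_adj (hmate v hv)).symm⟩
      · exact ⟨nb v, (hnb v).ne', hed_nb hv⟩
    intro v
    obtain ⟨u, huv, hu⟩ := hex v
    rw [← Finset.card_pair (fun h => huv (heinj h))]
    refine Finset.card_le_card fun x hx => ?_
    rw [Finset.mem_insert, Finset.mem_singleton] at hx
    rw [Finset.mem_filter, Finset.mem_range]
    rcases hx with rfl | rfl
    · exact ⟨hen u, hpe.2 hu⟩
    · exact ⟨hen v, rfl⟩
  set c : V → Fin (numGroups n p) := fun v =>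
    ⟨groupLabel n p (e v), groupLabel_lt (hen v) (hcard v)⟩ with hc
  have hced : ∀ {u v}, c u = c v → ed u = ed v := fun {u v} h =>
    hpe.1 (eq_of_rootCount_eq (hen u) (hen v) (hcard u) (hcard v)
      (rootCount_eq_of_groupLabel_eq (hen u) (hen v) (hcard u) (hcard v) (Fin.mk.inj_iff.1 h)))
  have hcM : ∀ {x y}, M.Adj x y → c x = c y := by
    have key : ∀ {x y}, M.Adj x y → e x < e y → c x = c y := by
      intro x y hxy hlt
      have hp' : p (e x) = p (e y) := hpe.2 (hed_adj hxy)
      have hfib : ∀ u < n, u < e y → p u = p (e y) → u = e x := by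
        intro u hu hlt hup
        obtain ⟨z, rfl⟩ := hes u hu
        have hz := hKM (helt.1 hlt) (M.edge_vert hxy.symm)
        rcases hed_matched hz (M.edge_vert hxy.symm) (hpe.1 hup) with rfl | h
        · exact absurd hlt (lt_irrefl _)
        · rw [hM.1.eq_of_adj_left h hxy.symm]
      have hr0 : fibreRank n p (e x) = 0 := by
        unfold fibreRank
        rw [Finset.card_eq_zero, Finset.filter_eq_empty_iff]
        rintro u hu ⟨h1, h2⟩
        have := hfib u (Finset.mem_range.1 hu) (h1.trans hlt) (h2.trans hp')
        omega
      have hr1 : fibreRank n p (e y) = 1 := by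
        unfold fibreRank
        rw [Finset.card_eq_one]
        refine ⟨e x, ?_⟩
        ext u
        simp only [Finset.mem_filter, Finset.mem_range, Finset.mem_singleton]
        constructor
        · rintro ⟨h1, h2, h3⟩
          exact hfib u h1 h2 h3
        · rintro rfl
          exact ⟨hen x, hlt, hp'⟩
      have := rootCount_eq_of_fibreRank_succ (hen x) (hen y) hp' (by rw [hr0, hr1])
        (fun h => by have := h.1; rw [hr1] at this; exact absurd this (by decide))
      exact Fin.ext (by simp only [hc, groupLabel, this])
    intro x y hxy
    rcases lt_trichotomy (e x) (e y) with h | h | h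
    · exact key hxy h
    · rw [heinj h]
    · exact (key hxy.symm h).symm
  have hrep : ∀ a, ∃ v, c v = a ∧ ((∃ u ∈ M.verts, c u = a) → v ∈ M.verts) := by
    intro a
    by_cases h : ∃ u ∈ M.verts, c u = a
    · obtain ⟨u, hu, hua⟩ := h
      exact ⟨u, hua, fun _ => hu⟩
    · obtain ⟨i, hi, -, hia⟩ := exists_groupLabel_eq a.2
      obtain ⟨v, rfl⟩ := hes i hi
      exact ⟨v, Fin.ext hia, fun h' => absurd h' h⟩
  choose rep hrepc hrepM using hrep
  have hcnear : ∀ u v, c u = c v → WithinTwo G u v := fun u v h => hnear u v (hced h)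
  refine ⟨fun v => rep (c v), isContractionMap_of_labelling hrepc hcnear ?_ ?_, ?_, ?_⟩
  · intro v
    obtain ⟨i, hi, hne, -, h⟩ := exists_ne_rootCount_eq (hen v) (hcard v)
    obtain ⟨u, rfl⟩ := hes i hi
    exact ⟨u, fun h => hne (by rw [h]), Fin.ext (by simp only [hc, groupLabel, h])⟩
  · intro T a hT
    rw [← Finset.card_image_of_injective T heinj]
    refine card_groupLabel_le_three (n := n) (p := p) (j := a) fun i hi => ?_
    obtain ⟨v, hv, rfl⟩ := Finset.mem_image.1 hi
    exact ⟨hen v, hcard v, congrArg Fin.val (hT v hv)⟩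
  · intro x y hxy
    have h1 := hrepM (c x) ⟨x, M.edge_vert hxy, rfl⟩
    simp only [← hcM hxy]
    rcases hed_matched h1 (M.edge_vert hxy) (hced (hrepc _)) with h | h
    · exact .inl ⟨h, h⟩
    · exact .inr (by rw [hM.1.eq_of_adj_left h hxy]; exact ⟨rfl, rfl⟩)
  · refine graphBandwidth_quotient_lt G _ (fun a => {v | rep (c v) = a}) (fun a => ⟨a, a.2⟩) ?_ ?_ ?_
      hb
    · intro a b v h1 h2
      exact Subtype.ext (h1.symm.trans h2)
    · intro a u hu v hv
      refine hcnear u v ?_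
      rw [← hrepc (c u), ← hrepc (c v), show rep (c u) = a from hu, show rep (c v) = a from hv]
    · rintro a b ⟨-, u, v, huv, hu, hv⟩
      exact ⟨u, hu, v, hv, huv⟩

end Matching

/-! ### Star partitions -/

/-- Adjacency of a graph on `0, …, n - 1` as a relation on natural numbers. -/
def FinGraph.adj (G : FinGraph) (i j : ℕ) : Prop :=
  ∃ (hi : i < G.n) (hj : j < G.n), G.graph.Adj ⟨i, hi⟩ ⟨j, hj⟩

theorem FinGraph.adj.symm {G : FinGraph} {i j : ℕ} (h : G.adj i j) : G.adj j i := by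
  obtain ⟨hi, hj, h⟩ := h
  exact ⟨hj, hi, h.symm⟩

theorem FinGraph.adj.ne {G : FinGraph} {i j : ℕ} (h : G.adj i j) : i ≠ j := by
  obtain ⟨hi, hj, h⟩ := h
  exact fun h' => h.ne (Fin.ext h')

theorem FinGraph.adj.lt_left {G : FinGraph} {i j : ℕ} (h : G.adj i j) : i < G.n := h.1

theorem FinGraph.adj.lt_right {G : FinGraph} {i j : ℕ} (h : G.adj i j) : j < G.n := h.2.1

theorem FinGraph.adj_val {G : FinGraph} {u v : Fin G.n} : G.adj u v ↔ G.graph.Adj u v :=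
  ⟨fun h => h.2.2, fun h => ⟨u.2, v.2, h⟩⟩

/-- The vertex `i` has a neighbour. -/
def FinGraph.NonIso (G : FinGraph) (i : ℕ) : Prop := ∃ j, G.adj i j

theorem FinGraph.NonIso.lt {G : FinGraph} {i : ℕ} (h : G.NonIso i) : i < G.n := by
  obtain ⟨j, h⟩ := h
  exact h.lt_left

/-- The least neighbour. -/
def FinGraph.nb (G : FinGraph) (i : ℕ) : ℕ := sInf {j | G.adj i j}

theorem FinGraph.NonIso.adj_nb {G : FinGraph} {i : ℕ} (h : G.NonIso i) : G.adj i (G.nb i) :=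
  Nat.sInf_mem (s := {j | G.adj i j}) h

open scoped Classical in
/-- If `v` forms a class of its own, then it joins its neighbour `w`, which becomes the centre of
the star that contains `v`. If `w` was the only leaf of another star, then the centre of that star
becomes a leaf of `w`. -/
def FinGraph.starStep (G : FinGraph) (p : ℕ → ℕ) (v : ℕ) : ℕ → ℕ :=
  if G.NonIso v ∧ fibreCard G.n p v ≤ 1 then fun i =>
    if i = v ∨ i = G.nb v ∨ (i = p (G.nb v) ∧ fibreCard G.n p (G.nb v) ≤ 2) then G.nb v else p i
  else p

/-- The map that sends every vertex to the centre of its star, once the vertices `0, …, k - 1`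
have been treated. -/
def FinGraph.starMap (G : FinGraph) : ℕ → ℕ → ℕ
  | 0 => id
  | k + 1 => G.starStep (G.starMap k) k

/-- The fibres of `p` are stars: a vertex is the centre of its star or adjacent to it. -/
structure FinGraph.IsStarMap (G : FinGraph) (p : ℕ → ℕ) : Prop where
  adj : ∀ i, p i = i ∨ G.adj i (p i)
  idem : ∀ i, p (p i) = p i

theorem FinGraph.IsStarMap.lt {G : FinGraph} {p : ℕ → ℕ} (hp : G.IsStarMap p) {i : ℕ}
    (hi : i < G.n) : p i < G.n := by
  rcases hp.adj i with h | h
  · rwa [h]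
  · exact h.lt_right

theorem two_le_fibreCard_iff {n : ℕ} {p : ℕ → ℕ} {u : ℕ} (hu : u < n) :
    2 ≤ fibreCard n p u ↔ ∃ w < n, w ≠ u ∧ p w = p u := by
  classical
  constructor
  · intro h
    obtain ⟨w, hw, hne⟩ := Finset.exists_mem_ne (show 1 < _ from h) u
    rw [Finset.mem_filter, Finset.mem_range] at hw
    exact ⟨w, hw.1, hne, hw.2⟩
  · rintro ⟨w, hw, hne, hp⟩
    rw [← Finset.card_pair hne]
    refine Finset.card_le_card fun x hx => ?_
    rw [Finset.mem_insert, Finset.mem_singleton] at hx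
    rw [Finset.mem_filter, Finset.mem_range]
    rcases hx with rfl | rfl
    · exact ⟨hw, hp⟩
    · exact ⟨hu, rfl⟩

theorem three_le_fibreCard {n : ℕ} {p : ℕ → ℕ} {u v w : ℕ} (hu : u < n) (hv : v < n) (hw : w < n)
    (huv : u ≠ v) (huw : u ≠ w) (hvw : v ≠ w) (hpu : p u = p w) (hpv : p v = p w) :
    3 ≤ fibreCard n p w := by
  classical
  rw [← Finset.card_eq_three.2 ⟨u, v, w, huv, huw, hvw, rfl⟩]
  refine Finset.card_le_card fun x hx => ?_
  rw [Finset.mem_insert, Finset.mem_insert, Finset.mem_singleton] at hx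
  rw [Finset.mem_filter, Finset.mem_range]
  rcases hx with rfl | rfl | rfl
  · exact ⟨hu, hpu⟩
  · exact ⟨hv, hpv⟩
  · exact ⟨hw, rfl⟩

theorem exists_third_of_fibreCard {n : ℕ} {p : ℕ → ℕ} {u w : ℕ} (h : 2 < fibreCard n p w) :
    ∃ s < n, s ≠ u ∧ s ≠ w ∧ p s = p w := by
  classical
  obtain ⟨s, hs, hs'⟩ := Finset.exists_mem_notMem_of_card_lt_card
    (lt_of_le_of_lt (Finset.card_le_two (a := u) (b := w)) h)
  rw [Finset.mem_filter, Finset.mem_range] at hs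
  simp only [Finset.mem_insert, Finset.mem_singleton, not_or] at hs'
  exact ⟨s, hs.1, hs'.1, hs'.2, hs.2⟩

/-- A step keeps the stars, leaves no vertex alone that was not alone before, and gives `v` a partner
if it has a neighbour. -/
theorem FinGraph.IsStarMap.starStep {G : FinGraph} {p : ℕ → ℕ} (hp : G.IsStarMap p) (v : ℕ) :
    G.IsStarMap (G.starStep p v) ∧
    (∀ u < G.n, 2 ≤ fibreCard G.n p u → 2 ≤ fibreCard G.n (G.starStep p v) u) ∧
    (G.NonIso v → 2 ≤ fibreCard G.n (G.starStep p v) v) := by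
  by_cases hc : G.NonIso v ∧ fibreCard G.n p v ≤ 1
  swap
  · rw [FinGraph.starStep, if_neg hc]
    refine ⟨hp, fun u _ h => h, fun h => ?_⟩
    by_contra hlt
    exact hc ⟨h, by omega⟩
  have hvw := hc.1.adj_nb
  have hv := hvw.lt_left
  have hw := hvw.lt_right
  set w := G.nb v with hwdef
  set x := p w with hx
  have halone : ∀ u < G.n, p u = p v → u = v := fun u hu h => by
    by_contra hne
    have := (two_le_fibreCard_iff hv).2 ⟨u, hu, hne, h⟩
    omega
  have hpv : p v = v := halone _ (hp.lt hv) (hp.idem v)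
  have hxn : x < G.n := hp.lt hw
  have hxv : x ≠ v := fun h => hvw.ne (halone w hw (by rw [hpv, ← h])).symm
  have hpx : p x = x := hp.idem w
  set q := G.starStep p v with hq
  have hqi : ∀ i, q i = if i = v ∨ i = w ∨ (i = x ∧ fibreCard G.n p w ≤ 2) then w else p i :=
    fun i => by rw [hq, FinGraph.starStep, if_pos hc]
  have hqv : q v = w := by rw [hqi, if_pos (.inl rfl)]
  have hqw : q w = w := by rw [hqi, if_pos (.inr (.inl rfl))]
  -- A further element of the star of `w`, when that star has at most two elements.
  have hsmall : ∀ i < G.n, i ≠ w → i ≠ x → p i = x → fibreCard G.n p w ≤ 2 → x = w := by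
    intro i hi hiw hix hpi hle
    by_contra hxw
    have := three_le_fibreCard hi hxn hw hix hiw hxw hpi hpx
    omega
  have hlt_of : ∀ i, p i < G.n → i < G.n := fun i h => by
    rcases hp.adj i with h' | h'
    · rwa [← h']
    · exact h'.lt_left
  refine ⟨⟨fun i => ?_, fun i => ?_⟩, fun u hu h => ?_, fun _ => ?_⟩
  · rw [hqi]
    split_ifs with h
    · rcases h with rfl | rfl | ⟨rfl, -⟩
      · exact .inr hvw
      · exact .inl rfl
      · rcases hp.adj w with h | h
        · exact .inl (hx.trans h).symm
        · exact .inr h.symm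
    · exact hp.adj i
  · by_cases h : i = v ∨ i = w ∨ (i = x ∧ fibreCard G.n p w ≤ 2)
    · rw [hqi i, if_pos h, hqw]
    · rw [hqi i, if_neg h, hqi]
      split_ifs with h'
      · push Not at h
        rcases h' with h' | h' | ⟨h', h''⟩
        · exact absurd (halone i (hlt_of i (h' ▸ hv)) (h'.trans hpv.symm)) h.1
        · exact h'.symm
        · have hin := hlt_of i (h' ▸ hxn)
          rw [h']
          exact (hsmall i hin h.2.1 (fun hi => absurd h'' (h.2.2 hi).not_ge) h' h'').symm
      · exact hp.idem i
  · rw [two_le_fibreCard_iff hu] at h ⊢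
    obtain ⟨t, ht, htu, hpt⟩ := h
    have huv : u ≠ v := fun h => htu (by rw [h]; exact halone t ht (h ▸ hpt))
    have htv : t ≠ v := fun h => htu (by rw [h]; exact (halone u hu (h ▸ hpt.symm)).symm)
    by_cases hqu : u = v ∨ u = w ∨ (u = x ∧ fibreCard G.n p w ≤ 2)
    · exact ⟨v, hv, huv.symm, by rw [hqv, hqi, if_pos hqu]⟩
    · have hqu' : q u = p u := by rw [hqi, if_neg hqu]
      by_cases hqt : t = v ∨ t = w ∨ (t = x ∧ fibreCard G.n p w ≤ 2)
      · have hpu : p u = x := by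
          rcases hqt with h | h | ⟨h, -⟩
          · exact absurd h htv
          · rw [← hpt, h]
          · rw [← hpt, h, hpx]
        push Not at hqu
        by_cases hle : fibreCard G.n p w ≤ 2
        · have hxw := hsmall u hu hqu.2.1 (fun h => absurd hle (hqu.2.2 h).not_ge) hpu hle
          exact ⟨w, hw, hqu.2.1.symm, by rw [hqw, hqu', hpu, hxw]⟩
        · obtain ⟨s, hs, hsu, hsw, hps⟩ := exists_third_of_fibreCard (u := u) (not_le.1 hle)
          refine ⟨s, hs, hsu, ?_⟩
          rw [hqu', hpu, hqi, if_neg, hps]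
          rintro (h | h | ⟨-, h⟩)
          · exact hxv (by rw [← hpv, ← h, hps])
          · exact hsw h
          · exact hle h
      · exact ⟨t, ht, htu, by rw [hqu', hqi, if_neg hqt, hpt]⟩
  · rw [two_le_fibreCard_iff hv]
    exact ⟨w, hw, hvw.ne.symm, by rw [hqw, hqv]⟩

theorem FinGraph.isStarMap_starMap (G : FinGraph) (k : ℕ) : G.IsStarMap (G.starMap k) ∧
    ∀ v < k, G.NonIso v → 2 ≤ fibreCard G.n (G.starMap k) v := by
  induction k with
  | zero => exact ⟨⟨fun i => .inl rfl, fun i => rfl⟩, fun v hv => absurd hv (Nat.not_lt_zero v)⟩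
  | succ k ih =>
    obtain ⟨h1, h2, h3⟩ := ih.1.starStep k
    refine ⟨h1, fun v hv hvi => ?_⟩
    rcases Nat.lt_succ_iff_lt_or_eq.1 hv with h | rfl
    · exact h2 v hvi.lt (ih.2 v h hvi)
    · exact h3 hvi

theorem FinGraph.starMap_eq_of_le (G : FinGraph) {k : ℕ} (hk : G.n ≤ k) :
    G.starMap k = G.starMap G.n := by
  induction k, hk using Nat.le_induction with
  | base => rfl
  | succ k hk ih =>
    rw [FinGraph.starMap, FinGraph.starStep, if_neg, ih]
    exact fun h => absurd h.1.lt hk.not_gt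

/-- The centres of the stars of the greedy star partition. -/
def FinGraph.star (G : FinGraph) : ℕ → ℕ := G.starMap G.n

theorem FinGraph.isStarMap_star (G : FinGraph) : G.IsStarMap G.star :=
  (G.isStarMap_starMap G.n).1

/-- Only isolated vertices form a star of their own in the end. -/
theorem FinGraph.two_le_fibreCard_star_iff {G : FinGraph} {v : ℕ} (hv : v < G.n) :
    2 ≤ fibreCard G.n G.star v ↔ G.NonIso v := by
  refine ⟨fun h => ?_, fun h => (G.isStarMap_starMap G.n).2 v hv h⟩
  by_contra hi
  obtain ⟨w, hw, hne, h⟩ := (two_le_fibreCard_iff hv).1 h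
  rcases G.isStarMap_star.adj v with h1 | h1
  · rcases G.isStarMap_star.adj w with h2 | h2
    · exact hne (by rw [← h2, h, h1])
    · rw [h, h1] at h2
      exact hi ⟨w, h2.symm⟩
  · exact hi ⟨_, h1⟩

/-! ### Coarsening -/

/-- The graph obtained by dropping the isolated vertices and contracting the groups into which the
stars are split. -/
def FinGraph.coarsen (G : FinGraph) : FinGraph where
  n := numGroups G.n G.star
  graph :=
    { Adj := fun a b => a ≠ b ∧ ∃ u v, G.adj u v ∧ groupLabel G.n G.star u = a ∧
        groupLabel G.n G.star v = b
      symm := ⟨fun _ _ h => ⟨h.1.symm, by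
        obtain ⟨u, v, huv, hu, hv⟩ := h.2
        exact ⟨v, u, huv.symm, hv, hu⟩⟩⟩
      loopless := ⟨fun _ h => h.1 rfl⟩ }

open scoped Classical in
/-- The vertex of the coarsened graph to which a vertex is contracted. An isolated vertex receives a
label of its own that is not a vertex of the coarsened graph, and so does every number that is not
a vertex of `G`; these numbers occur as labels of classes dropped at an earlier stage. -/
def FinGraph.coarsenLabel (G : FinGraph) (i : ℕ) : ℕ :=
  if G.NonIso i then groupLabel G.n G.star i else G.n + i

theorem FinGraph.NonIso.coarsenLabel {G : FinGraph} {i : ℕ} (h : G.NonIso i) :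
    G.coarsenLabel i = groupLabel G.n G.star i := if_pos h

theorem FinGraph.NonIso.coarsenLabel_lt {G : FinGraph} {i : ℕ} (h : G.NonIso i) :
    G.coarsenLabel i < G.coarsen.n := by
  rw [h.coarsenLabel]
  exact groupLabel_lt h.lt ((two_le_fibreCard_star_iff h.lt).2 h)

theorem FinGraph.star_eq_of_groupLabel_eq {G : FinGraph} {u v : ℕ} (hu : G.NonIso u)
    (hv : G.NonIso v) (h : groupLabel G.n G.star u = groupLabel G.n G.star v) :
    G.star u = G.star v := by
  have hu2 := (two_le_fibreCard_star_iff hu.lt).2 hu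
  have hv2 := (two_le_fibreCard_star_iff hv.lt).2 hv
  exact eq_of_rootCount_eq hu.lt hv.lt hu2 hv2 (rootCount_eq_of_groupLabel_eq hu.lt hv.lt hu2 hv2 h)

theorem FinGraph.IsStarMap.exists_adj {G : FinGraph} {p : ℕ → ℕ} (hp : G.IsStarMap p) {u v : ℕ}
    (h : p u = p v) : u = v ∨ G.adj u v ∨ ∃ x, G.adj u x ∧ G.adj x v := by
  rcases hp.adj u with h1 | h1 <;> rcases hp.adj v with h2 | h2
  · exact .inl (by rw [← h1, h, h2])
  · rw [← h, h1] at h2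
    exact .inr (.inl h2.symm)
  · rw [h, h2] at h1
    exact .inr (.inl h1)
  · rw [← h] at h2
    exact .inr (.inr ⟨_, h1, h2.symm⟩)

theorem FinGraph.mem_support_iff {G : FinGraph} {v : Fin G.n} :
    v ∈ G.graph.support ↔ G.NonIso v := by
  rw [SimpleGraph.mem_support]
  exact ⟨fun ⟨w, h⟩ => ⟨w, adj_val.2 h⟩, fun ⟨w, h⟩ => ⟨⟨w, h.lt_right⟩, h.2.2⟩⟩

/-- The coarsened graph is a contraction of the graph without isolated vertices. -/
theorem FinGraph.exists_contraction_coarsen (G : FinGraph) :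
    ∃ ρ : G.graph.support → G.graph.support,
      IsContractionMap (G.graph.induce G.graph.support) ρ ∧
      Nonempty (G.coarsen.graph ≃g contractGraph (G.graph.induce G.graph.support) ρ) := by
  have hni : ∀ v : G.graph.support, G.NonIso v.1 := fun v => mem_support_iff.1 v.2
  have h2 : ∀ v : G.graph.support, 2 ≤ fibreCard G.n G.star v.1 := fun v =>
    (two_le_fibreCard_star_iff (hni v).lt).2 (hni v)
  set c : G.graph.support → Fin G.coarsen.n := fun v =>
    ⟨groupLabel G.n G.star v.1, groupLabel_lt (hni v).lt (h2 v)⟩ with hc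
  have hex : ∀ i < G.n, 2 ≤ fibreCard G.n G.star i → ∃ v : G.graph.support, (v.1 : ℕ) = i :=
    fun i hi h =>
      ⟨⟨⟨i, hi⟩, mem_support_iff.2 ((two_le_fibreCard_star_iff hi).1 h)⟩, rfl⟩
  have hsurj : ∀ a, ∃ v, c v = a := fun a => by
    obtain ⟨i, hi, h, ha⟩ := exists_groupLabel_eq a.2
    obtain ⟨v, rfl⟩ := hex i hi h
    exact ⟨v, Fin.ext ha⟩
  choose rep hrep using hsurj
  refine ⟨fun v => rep (c v), isContractionMap_of_labelling hrep ?_ ?_ ?_,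
    nonempty_iso_contractGraph hrep ?_⟩
  · intro u v huv
    have hstar := star_eq_of_groupLabel_eq (hni u) (hni v) (Fin.mk.inj_iff.1 huv)
    rcases G.isStarMap_star.exists_adj hstar with h | h | ⟨x, h1, h3⟩
    · exact .inl (Subtype.ext (Fin.ext h))
    · exact .inr (.inl (adj_val.1 h))
    · exact .inr (.inr ⟨⟨⟨x, h1.lt_right⟩, mem_support_iff.2 ⟨_, h3⟩⟩, h1.2.2, h3.2.2⟩)
  · intro v
    obtain ⟨i, hi, hne, hp, h⟩ := exists_ne_rootCount_eq (hni v).lt (h2 v)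
    obtain ⟨u, rfl⟩ := hex i hi (by rw [fibreCard_congr hp]; exact h2 v)
    exact ⟨u, fun h => hne (by rw [h]), Fin.ext (by simp only [hc, groupLabel, h])⟩
  · intro T a hT
    rw [← Finset.card_image_of_injective T
      (show Function.Injective fun v : G.graph.support => (v.1 : ℕ) from
        Fin.val_injective.comp Subtype.val_injective)]
    refine card_groupLabel_le_three (n := G.n) (p := G.star) (j := a) fun i hi => ?_
    obtain ⟨v, hv, rfl⟩ := Finset.mem_image.1 hi
    exact ⟨(hni v).lt, h2 v, congrArg Fin.val (hT v hv)⟩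
  · intro a b
    refine and_congr_right fun _ => ⟨?_, ?_⟩
    · rintro ⟨u, v, huv, hu, hv⟩
      exact ⟨⟨⟨u, huv.lt_left⟩, mem_support_iff.2 ⟨_, huv⟩⟩,
        ⟨⟨v, huv.lt_right⟩, mem_support_iff.2 ⟨_, huv.symm⟩⟩, huv.2.2, Fin.ext hu, Fin.ext hv⟩
    · rintro ⟨u, v, huv, hu, hv⟩
      exact ⟨u.1, v.1, adj_val.2 huv, congrArg Fin.val hu, congrArg Fin.val hv⟩

theorem FinGraph.two_mul_coarsen_n_le (G : FinGraph) : 2 * G.coarsen.n ≤ G.n := by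
  obtain ⟨ρ, hρ, ⟨φ⟩⟩ := G.exists_contraction_coarsen
  have h1 : G.coarsen.n = {v | ρ v = v}.ncard := by
    rw [← Nat.card_coe_set_eq, ← Nat.card_fin G.coarsen.n]
    exact Nat.card_congr φ.toEquiv
  have h2 := hρ.half
  have h3 := Nat.card_le_card_of_injective (fun v : G.graph.support => v.1)
    Subtype.val_injective
  rw [Nat.card_fin] at h3
  omega

theorem FinGraph.graphBandwidth_coarsen_lt (G : FinGraph) (hG : 1 ≤ graphBandwidth G.graph) :
    graphBandwidth G.coarsen.graph + 1 ≤ 3 * graphBandwidth G.graph := by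
  refine graphBandwidth_quotient_lt G.graph _
    (fun a => {v : Fin G.n | G.NonIso v ∧ groupLabel G.n G.star v = a}) ?_ ?_ ?_ ?_ hG
  · intro a
    obtain ⟨i, hi, h, ha⟩ := exists_groupLabel_eq a.2
    exact ⟨⟨i, hi⟩, (two_le_fibreCard_star_iff hi).1 h, ha⟩
  · intro a b v h1 h2
    exact Fin.ext (h1.2.symm.trans h2.2)
  · intro a u hu v hv
    have hstar := star_eq_of_groupLabel_eq hu.1 hv.1 (hu.2.trans hv.2.symm)
    rcases G.isStarMap_star.exists_adj hstar with h | h | ⟨x, h1, h3⟩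
    · exact .inl (Fin.ext h)
    · exact .inr (.inl (adj_val.1 h))
    · exact .inr (.inr ⟨⟨x, h1.lt_right⟩, h1.2.2, h3.2.2⟩)
  · rintro a b ⟨-, u, v, huv, hu, hv⟩
    exact ⟨⟨u, huv.lt_left⟩, ⟨⟨_, huv⟩, hu⟩, ⟨v, huv.lt_right⟩, ⟨⟨_, huv.symm⟩, hv⟩, huv.2.2⟩

theorem FinGraph.one_le_graphBandwidth_of_adj {G : FinGraph} {u v : ℕ} (h : G.adj u v) :
    1 ≤ graphBandwidth G.graph := one_le_graphBandwidth G.graph h.2.2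

theorem FinGraph.card_coarsenLabel_le_three {G : FinGraph} {T : Finset ℕ} {j : ℕ}
    (hT : ∀ v ∈ T, G.coarsenLabel v = j) : T.card ≤ 3 := by
  have hcn := G.two_mul_coarsen_n_le
  by_cases h : ∃ v ∈ T, ¬ G.NonIso v
  · obtain ⟨v, hv, hi⟩ := h
    have hj := hT v hv
    rw [FinGraph.coarsenLabel, if_neg hi] at hj
    have : T ⊆ {v} := fun u hu => by
      rw [Finset.mem_singleton]
      have hj' := hT u hu
      by_cases hi' : G.NonIso u
      · have := hi'.coarsenLabel_lt
        omega
      · rw [FinGraph.coarsenLabel, if_neg hi'] at hj'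
        omega
    have := Finset.card_le_card this
    rw [Finset.card_singleton] at this
    omega
  · push Not at h
    exact card_groupLabel_le_three fun v hv => ⟨(h v hv).lt,
      (two_le_fibreCard_star_iff (h v hv).lt).2 (h v hv), by
        rw [← (h v hv).coarsenLabel]
        exact hT v hv⟩

theorem FinGraph.adj_coarsen {G : FinGraph} {u v : ℕ} (h : G.adj u v) :
    G.coarsenLabel u = G.coarsenLabel v ∨
      G.coarsen.adj (G.coarsenLabel u) (G.coarsenLabel v) := by
  by_cases heq : G.coarsenLabel u = G.coarsenLabel v
  · exact .inl heq
  · have hu : G.NonIso u := ⟨_, h⟩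
    have hv : G.NonIso v := ⟨_, h.symm⟩
    exact .inr ⟨hu.coarsenLabel_lt, hv.coarsenLabel_lt, fun h => heq (Fin.mk.inj_iff.1 h),
      u, v, h, hu.coarsenLabel.symm, hv.coarsenLabel.symm⟩

theorem FinGraph.adj_coarsen_iff {G : FinGraph} {a b : ℕ} : G.coarsen.adj a b ↔
    a ≠ b ∧ ∃ u v, G.adj u v ∧ G.coarsenLabel u = a ∧ G.coarsenLabel v = b := by
  constructor
  · rintro ⟨ha, hb, hne, u, v, huv, hu, hv⟩
    exact ⟨fun h => hne (Fin.ext h), u, v, huv,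
      (NonIso.coarsenLabel ⟨_, huv⟩).trans hu, (NonIso.coarsenLabel ⟨_, huv.symm⟩).trans hv⟩
  · rintro ⟨hne, u, v, huv, rfl, rfl⟩
    exact (adj_coarsen huv).resolve_left hne

/-! ### Repeated coarsening -/

/-- The graph after `k` coarsening steps. -/
def FinGraph.level (G : FinGraph) : ℕ → FinGraph
  | 0 => G
  | k + 1 => (G.level k).coarsen

/-- The label of a vertex after `k` coarsening steps. The labels below `(G.level k).n` are the
vertices of `G.level k`; a vertex whose class has been dropped has a larger label, which identifies
that class. -/
def FinGraph.label (G : FinGraph) : ℕ → ℕ → ℕ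
  | 0 => id
  | k + 1 => fun i => (G.level k).coarsenLabel (G.label k i)

theorem FinGraph.pow_mul_level_n_le (G : FinGraph) (k : ℕ) : 2 ^ k * (G.level k).n ≤ G.n := by
  induction k with
  | zero => simp [FinGraph.level]
  | succ k ih =>
    have h := Nat.mul_le_mul_left (2 ^ k) (G.level k).two_mul_coarsen_n_le
    rw [pow_succ, mul_assoc]
    exact h.trans ih

theorem FinGraph.card_label_le {G : FinGraph} {k : ℕ} {T : Finset ℕ} {j : ℕ}
    (hT : ∀ v ∈ T, G.label k v = j) : T.card ≤ 3 ^ k := by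
  induction k generalizing T j with
  | zero =>
    rw [pow_zero, Finset.card_le_one]
    exact fun a ha b hb => (hT a ha).trans (hT b hb).symm
  | succ k ih =>
    have h1 : (T.image (G.label k)).card ≤ 3 :=
      card_coarsenLabel_le_three (G := G.level k) (j := j) fun v hv => by
        obtain ⟨u, hu, rfl⟩ := Finset.mem_image.1 hv
        exact hT u hu
    have h2 := Finset.card_le_mul_card_image (f := G.label k) T (3 ^ k) fun a _ =>
      ih fun v hv => (Finset.mem_filter.1 hv).2
    calc T.card ≤ 3 ^ k * (T.image (G.label k)).card := h2
      _ ≤ 3 ^ k * 3 := Nat.mul_le_mul_left _ h1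
      _ = 3 ^ (k + 1) := (pow_succ _ _).symm

theorem FinGraph.adj_label {G : FinGraph} {u v : ℕ} (h : G.adj u v) (k : ℕ) :
    G.label k u = G.label k v ∨ (G.level k).adj (G.label k u) (G.label k v) := by
  induction k with
  | zero => exact .inr h
  | succ k ih =>
    rcases ih with h | h
    · exact .inl (congrArg (G.level k).coarsenLabel h)
    · exact adj_coarsen h

theorem FinGraph.graphBandwidth_level_lt {G : FinGraph} (hG : 1 ≤ graphBandwidth G.graph) (k : ℕ) :
    graphBandwidth (G.level (k + 1)).graph + 1 ≤ 3 ^ (k + 1) * graphBandwidth G.graph := by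
  induction k with
  | zero => exact G.graphBandwidth_coarsen_lt hG
  | succ k ih =>
    change graphBandwidth (G.level (k + 2)).graph + 1 ≤ 3 ^ (k + 2) * graphBandwidth G.graph
    rcases Nat.eq_zero_or_pos (graphBandwidth (G.level (k + 1)).graph) with h0 | h0
    · have h1 : graphBandwidth (G.level (k + 2)).graph ≤ 0 := by
        refine (graphBandwidth_le _ (Finite.equivFin _)).trans (orderingBandwidth_le _ ?_)
        rintro a b ⟨-, u, v, huv, -, -⟩
        have := one_le_graphBandwidth_of_adj huv
        omega
      have h2 : 1 ≤ 3 ^ (k + 2) := Nat.one_le_pow _ _ (by norm_num)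
      have h3 := Nat.mul_le_mul h2 hG
      omega
    · have h1 := (G.level (k + 1)).graphBandwidth_coarsen_lt h0
      have h2 : 3 ^ (k + 2) * graphBandwidth G.graph =
        3 * (3 ^ (k + 1) * graphBandwidth G.graph) := by ring
      have h3 : graphBandwidth (G.level (k + 2)).graph =
        graphBandwidth (G.level (k + 1)).coarsen.graph := rfl
      omega

/-- The position of the class of `v` in an ordering of the coarsened graph. A dropped class keeps
its label as position. -/
def FinGraph.mergeKey (G : FinGraph) (k : ℕ) (π : VertexOrdering (Fin (G.level k).n)) (v : ℕ) : ℕ :=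
  if h : G.label k v < (G.level k).n then π ⟨G.label k v, h⟩ else G.label k v

theorem FinGraph.label_eq_of_mergeKey_eq {G : FinGraph} {k : ℕ}
    {π : VertexOrdering (Fin (G.level k).n)} {u v : ℕ} (h : G.mergeKey k π u = G.mergeKey k π v) :
    G.label k u = G.label k v := by
  have hπ : ∀ a, (π a : ℕ) < (G.level k).n := fun a => (π a).2.trans_eq (Nat.card_fin _)
  unfold FinGraph.mergeKey at h
  split_ifs at h with h1 h2 h2
  · exact Fin.mk.inj_iff.1 (π.injective (Fin.ext h))
  · exact absurd (h ▸ hπ _) h2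
  · exact absurd (h ▸ hπ _) h1
  · exact h

/-- The key by which the merger sorts: the position of the class, ties being broken by number. -/
def FinGraph.sortKey (G : FinGraph) (k : ℕ) (π : VertexOrdering (Fin (G.level k).n))
    (v : Fin G.n) : ℕ := G.mergeKey k π v * G.n + v

theorem FinGraph.sortKey_lt_iff {G : FinGraph} {k : ℕ} {π : VertexOrdering (Fin (G.level k).n)}
    {u v : Fin G.n} : G.sortKey k π u < G.sortKey k π v ↔ G.mergeKey k π u < G.mergeKey k π v ∨
      G.mergeKey k π u = G.mergeKey k π v ∧ (u : ℕ) < v := by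
  have h := fibreKey_le_iff (p := G.mergeKey k π) v.2 u.2
  unfold FinGraph.sortKey
  omega

theorem FinGraph.sortKey_injective (G : FinGraph) (k : ℕ)
    (π : VertexOrdering (Fin (G.level k).n)) : Function.Injective (G.sortKey k π) := by
  intro u v h
  have h1 := sortKey_lt_iff (k := k) (π := π) (u := u) (v := v)
  have h2 := sortKey_lt_iff (k := k) (π := π) (u := v) (v := u)
  exact Fin.ext (by omega)

/-- The ordering computed by the merger. -/
def FinGraph.mergeOrdering (G : FinGraph) (k : ℕ) (π : VertexOrdering (Fin (G.level k).n)) :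
    VertexOrdering (Fin G.n) := keyOrdering (G.sortKey k π) (G.sortKey_injective k π)

theorem FinGraph.orderingBandwidth_mergeOrdering_le (G : FinGraph) (k : ℕ)
    (π : VertexOrdering (Fin (G.level k).n)) : orderingBandwidth G.graph (G.mergeOrdering k π) ≤
      3 ^ k * orderingBandwidth (G.level k).graph π + 3 ^ k - 1 := by
  refine orderingBandwidth_keyOrdering_le G.graph _ (fun v => G.mergeKey k π v) _ ?_ ?_ ?_
  · intro u v h
    rcases sortKey_lt_iff.1 h with h | h
    · exact h.le
    · exact h.1.le
  · intro x
    rw [Set.ncard_eq_toFinset_card _ (Set.toFinite _),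
      ← Finset.card_image_of_injective _ Fin.val_injective]
    rcases (Set.toFinite {v : Fin G.n | G.mergeKey k π v = x}).toFinset.eq_empty_or_nonempty with
      h | ⟨u, hu⟩
    · rw [h]
      simp
    · refine card_label_le (G := G) (k := k) (j := G.label k u) fun v hv => ?_
      obtain ⟨w, hw, rfl⟩ := Finset.mem_image.1 hv
      have hu' : G.mergeKey k π u = x := by simpa using hu
      have hv' : G.mergeKey k π w = x := by simpa using hw
      exact label_eq_of_mergeKey_eq (hv'.trans hu'.symm)
  · intro u v huv
    rcases adj_label (adj_val.2 huv) k with h | h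
    · unfold FinGraph.mergeKey
      simp only [h]
      omega
    · unfold FinGraph.mergeKey
      rw [dif_pos h.lt_left, dif_pos h.lt_right]
      have := dist_le_orderingBandwidth _ π h.2.2
      unfold Nat.dist at this
      omega

/-- With `b` the bandwidth of `G` and `k ≥ 1`, the cost is at most
`3 ^ k * α * (3 ^ k * b - 1) + 3 ^ k - 1`, which is less than `9 ^ k * α * b` because `α ≥ 1`. -/
theorem FinGraph.mergeOrdering_cost_le (G : FinGraph) (k : ℕ)
    (π : VertexOrdering (Fin (G.level k).n)) (α : ℝ) (hα : 1 ≤ α)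
    (h : (orderingBandwidth (G.level k).graph π : ℝ) ≤
      α * (graphBandwidth (G.level k).graph : ℝ)) :
    (orderingBandwidth G.graph (G.mergeOrdering k π) : ℝ) ≤
      9 ^ k * α * (graphBandwidth G.graph : ℝ) := by
  rcases Nat.eq_zero_or_pos (graphBandwidth G.graph) with h0 | h0
  · have h1 : orderingBandwidth G.graph (G.mergeOrdering k π) ≤ 0 :=
      orderingBandwidth_le _ fun u v huv _ => by
        have := one_le_graphBandwidth _ huv
        omega
    rw [Nat.le_zero.1 h1, h0]
    simp
  have h1 := G.orderingBandwidth_mergeOrdering_le k π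
  have h2 : 1 ≤ 3 ^ k := Nat.one_le_pow _ _ (by norm_num)
  have h3 : (orderingBandwidth G.graph (G.mergeOrdering k π) : ℝ) + 1 ≤
      3 ^ k * (orderingBandwidth (G.level k).graph π : ℝ) + 3 ^ k := by
    have : orderingBandwidth G.graph (G.mergeOrdering k π) + 1 ≤
      3 ^ k * orderingBandwidth (G.level k).graph π + 3 ^ k := by omega
    exact_mod_cast this
  have h4 : (1 : ℝ) ≤ 3 ^ k := by exact_mod_cast h2
  have h5 := mul_le_mul_of_nonneg_left h (by linarith : (0 : ℝ) ≤ 3 ^ k)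
  cases k with
  | zero =>
    simp only [pow_zero, one_mul] at h3 h5 ⊢
    have h6 : (graphBandwidth (G.level 0).graph : ℝ) = graphBandwidth G.graph := rfl
    rw [h6] at h5
    linarith
  | succ k =>
    have h6 : (graphBandwidth (G.level (k + 1)).graph : ℝ) + 1 ≤
        3 ^ (k + 1) * (graphBandwidth G.graph : ℝ) := by
      exact_mod_cast graphBandwidth_level_lt h0 k
    have h7 := mul_le_mul_of_nonneg_left h6 (by positivity : (0 : ℝ) ≤ 3 ^ (k + 1) * α)
    have h8 : (9 : ℝ) ^ (k + 1) = 3 ^ (k + 1) * 3 ^ (k + 1) := by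
      rw [← mul_pow]
      norm_num
    have h9 := mul_le_mul_of_nonneg_left hα (by linarith : (0 : ℝ) ≤ 3 ^ (k + 1))
    rw [h8]
    nlinarith

/-! ### A loop language for the random access machine -/

/-- The program `p` leads from `s` to `s'` in at most `T` steps. -/
def Runs (p : Ram) (s s' : RamState) (T : ℕ) : Prop := ∃ t ≤ T, RamExec p s s' t

theorem Runs.mono {p : Ram} {s s' : RamState} {T U : ℕ} (h : Runs p s s' T) (hTU : T ≤ U) :
    Runs p s s' U := by
  obtain ⟨t, ht, h⟩ := h
  exact ⟨t, ht.trans hTU, h⟩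

theorem Runs.seq {p q : Ram} {s₁ s₂ s₃ : RamState} {T U : ℕ} (h : Runs p s₁ s₂ T)
    (h' : Runs q s₂ s₃ U) : Runs (.seq p q) s₁ s₃ (T + U) := by
  obtain ⟨t, ht, h⟩ := h
  obtain ⟨u, hu, h'⟩ := h'
  exact ⟨t + u, add_le_add ht hu, .seq h h'⟩

theorem Runs.cond {x : ℕ} {p q : Ram} {s s' : RamState} {T : ℕ}
    (h : Runs (if s.var x ≠ 0 then p else q) s s' T) : Runs (.cond x p q) s s' (T + 1) := by
  obtain ⟨t, ht, h⟩ := h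
  refine ⟨t + 1, by omega, ?_⟩
  split_ifs at h with h0
  · exact .condTrue h0 h
  · exact .condFalse (not_not.1 h0) h

/-- A loop that counts a register down from `N` maintains an invariant. -/
theorem exists_runs_loop {x N T : ℕ} {p : Ram} (I : ℕ → RamState → Prop)
    (hx : ∀ i s, I i s → s.var x = N - i)
    (hstep : ∀ i < N, ∀ s, I i s → ∃ s', Runs p s s' T ∧ I (i + 1) s') {s : RamState}
    (hs : I 0 s) : ∃ s', Runs (.loop x p) s s' (N * (T + 1) + 1) ∧ I N s' := by
  have key : ∀ k i s, i + k = N → I i s →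
      ∃ s', Runs (.loop x p) s s' (k * (T + 1) + 1) ∧ I N s' := by
    intro k
    induction k with
    | zero =>
      intro i s hi hI
      have h0 := hx i s hI
      obtain rfl : i = N := hi
      exact ⟨s, ⟨1, by omega, .loopDone (by omega)⟩, hI⟩
    | succ k ih =>
      intro i s hi hI
      have h0 := hx i s hI
      obtain ⟨s₁, ⟨t, ht, h1⟩, hI1⟩ := hstep i (by omega) s hI
      obtain ⟨s₂, ⟨u, hu, h2⟩, hI2⟩ := ih (i + 1) s₁ (by omega) hI1
      refine ⟨s₂, ⟨t + u + 1, ?_, .loopStep (by omega) h1 h2⟩, hI2⟩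
      rw [add_mul]
      omega
  exact key N 0 s (by omega) hs

/-- The temporary registers of compiled programs are the positive even registers. Register `0` holds
the length of the input and is never changed. -/
def tmp (t : ℕ) : ℕ := 2 * t + 2

/-- The variables of the source language are kept in the odd registers. -/
def usr (x : ℕ) : ℕ := 2 * x + 1

/-- The state after assigning `c` to register `x`. -/
def RamState.assign (s : RamState) (x c : ℕ) : RamState :=
  { s with var := Function.update s.var x c }

theorem RamState.assign_var (s : RamState) (x c y : ℕ) :
    (s.assign x c).var y = if y = x then c else s.var y := Function.update_apply _ _ _ _

theorem RamState.assign_arr (s : RamState) (x c : ℕ) : (s.assign x c).arr = s.arr := rfl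

theorem RamState.assign_out (s : RamState) (x c : ℕ) : (s.assign x c).out = s.out := rfl

theorem runs_const (x c : ℕ) (s : RamState) : Runs (.const x c) s (s.assign x c) 1 :=
  ⟨1, le_rfl, .const x c s⟩

theorem runs_add (x y z : ℕ) (s : RamState) :
    Runs (.add x y z) s (s.assign x (s.var y + s.var z)) 1 := ⟨1, le_rfl, .add x y z s⟩

theorem runs_sub (x y z : ℕ) (s : RamState) :
    Runs (.sub x y z) s (s.assign x (s.var y - s.var z)) 1 := ⟨1, le_rfl, .sub x y z s⟩

theorem runs_read (x a y : ℕ) (s : RamState) :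
    Runs (.read x a y) s (s.assign x (s.arr a (s.var y))) 1 := ⟨1, le_rfl, .read x a y s⟩

/-- Copy register `y` to register `x`. -/
def copyCode (x y : ℕ) : Ram := .seq (.const x 0) (.add x x y)

theorem runs_copy {x y : ℕ} (h : y ≠ x) (s : RamState) :
    Runs (copyCode x y) s ((s.assign x 0).assign x (s.var y)) 2 := by
  have h1 := runs_add x x y (s.assign x 0)
  simp only [RamState.assign_var, if_true, if_neg h, zero_add] at h1
  exact (runs_const x 0 s).seq h1

/-- Run `p` for the values `0, …, L - 1` of the variable `x`, where `L` is the length of the input,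
and restore `x`. The temporary registers `t`, …, `t + 3` are used for the number of rounds left,
the next value, the constant one, and the old value of `x`. -/
def forCode (t x : ℕ) (p : Ram) : Ram :=
  .seq (copyCode (tmp (t + 3)) (usr x)) <| .seq (copyCode (tmp t) 0) <|
  .seq (.const (tmp (t + 1)) 0) <| .seq (.const (tmp (t + 2)) 1) <|
  .seq (.loop (tmp t) <| .seq (copyCode (usr x) (tmp (t + 1))) <| .seq p <|
    .seq (.add (tmp (t + 1)) (tmp (t + 1)) (tmp (t + 2)))
      (.sub (tmp t) (tmp t) (tmp (t + 2)))) <|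
  copyCode (usr x) (tmp (t + 3))

/-- The states `s` and `s'` agree up to the temporary registers from `t` on. -/
structure SameUpTo (t : ℕ) (s s' : RamState) : Prop where
  arr : s'.arr = s.arr
  out : s'.out = s.out
  var : ∀ k, (∀ j, t ≤ j → k ≠ tmp j) → s'.var k = s.var k

/-- An invariant that does not depend on the registers of the loop, and that the body maintains
without touching the four control registers, holds after the loop. -/
theorem exists_runs_forCode {t x T L : ℕ} {p : Ram} (I : ℕ → RamState → Prop)
    (hI : ∀ i s s', I i s → s'.arr = s.arr → s'.out = s.out →
      (∀ k, k ≠ usr x → (∀ j, t ≤ j → k ≠ tmp j) → s'.var k = s.var k) → I i s')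
    (hL : ∀ i s, I i s → s.var 0 = L)
    (hp : ∀ i < L, ∀ s, I i s → s.var (usr x) = i → ∃ s', Runs p s s' T ∧ I (i + 1) s' ∧
      ∀ j < 4, s'.var (tmp (t + j)) = s.var (tmp (t + j))) {s : RamState} (hs : I 0 s) :
    ∃ s', Runs (forCode t x p) s s' (L * (T + 5) + 9) ∧ I L s' ∧
      s'.var (usr x) = s.var (usr x) := by
  set v₀ := s.var (usr x) with hv₀
  have hn : ∀ j k, tmp (t + j) = tmp (t + k) ↔ j = k := fun j k => by unfold tmp; omega
  have hn1 : ∀ j, tmp (t + j) = tmp t ↔ j = 0 := fun j => by unfold tmp; omega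
  have hn2 : ∀ j, tmp t = tmp (t + j) ↔ 0 = j := fun j => by unfold tmp; omega
  have hux : ∀ j, usr x ≠ tmp j := fun j => by unfold usr tmp; omega
  have hxu : ∀ j, tmp j ≠ usr x := fun j => (hux j).symm
  have h0 : ∀ j, 0 ≠ tmp j := fun j => by unfold tmp; omega
  -- The invariant of the loop also describes the registers that control it.
  set J : ℕ → RamState → Prop := fun i s => I i s ∧ s.var (tmp t) = L - i ∧
    s.var (tmp (t + 1)) = i ∧ s.var (tmp (t + 2)) = 1 ∧ s.var (tmp (t + 3)) = v₀ with hJ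
  have hassign : ∀ i s y c, I i s → (y = usr x ∨ ∃ j, t ≤ j ∧ y = tmp j) → I i (s.assign y c) := by
    intro i s y c h hy
    refine hI i s _ h rfl rfl fun k hk hk' => ?_
    rw [RamState.assign_var, if_neg]
    rintro rfl
    rcases hy with h | ⟨j, hj, h⟩
    · exact hk h
    · exact hk' j hj h
  obtain ⟨s₁, hs₁⟩ : ∃ s₁, s₁ = (((((((s.assign (tmp (t + 3)) 0).assign (tmp (t + 3)) v₀).assign
    (tmp t) 0).assign (tmp t) L)).assign (tmp (t + 1)) 0).assign (tmp (t + 2)) 1) := ⟨_, rfl⟩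
  have hI1 : J 0 s₁ := by
    subst hs₁
    refine ⟨?_, ?_, ?_, ?_, ?_⟩
    · iterate 6 refine hassign _ _ _ _ ?_ (.inr ⟨_, by omega, rfl⟩)
      exact hs
    all_goals
      simp only [RamState.assign_var, hn, hn1, hn2]
      norm_num
  have hloop := exists_runs_loop (x := tmp t) (N := L) (T := T + 4)
    (p := .seq (copyCode (usr x) (tmp (t + 1))) <| .seq p <|
      .seq (.add (tmp (t + 1)) (tmp (t + 1)) (tmp (t + 2)))
      (.sub (tmp t) (tmp t) (tmp (t + 2)))) J (fun i s h => h.2.1) ?_ hI1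
  · obtain ⟨s₂, hrun, hJ2⟩ := hloop
    refine ⟨_, ?_, hassign L _ (usr x) v₀ (hassign L s₂ (usr x) 0 hJ2.1 (.inl rfl)) (.inl rfl), ?_⟩
    · have h1 := runs_copy (hux (t + 3)) s
      have h2 := runs_copy (h0 t) ((s.assign (tmp (t + 3)) 0).assign (tmp (t + 3)) v₀)
      have h3 := runs_copy (hxu (t + 3)) s₂
      simp only [RamState.assign_var, if_neg (h0 _), hL _ _ hs] at h2
      rw [hJ2.2.2.2.2] at h3
      subst hs₁
      exact (h1.seq (h2.seq ((runs_const _ _ _).seq ((runs_const _ _ _).seq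
        (hrun.seq h3))))).mono (by rw [show T + 4 + 1 = T + 5 from rfl]; omega)
    · rw [RamState.assign_var, if_pos rfl]
  · rintro i hi s ⟨hIs, h1, h2, h3, h4⟩
    have hr1 := runs_copy (hxu (t + 1)) s
    rw [h2] at hr1
    obtain ⟨s', hr2, hIs', hk⟩ := hp i hi _ (hassign i _ (usr x) i
      (hassign i s (usr x) 0 hIs (.inl rfl)) (.inl rfl)) (by rw [RamState.assign_var, if_pos rfl])
    have hk' : ∀ j < 4, s'.var (tmp (t + j)) = s.var (tmp (t + j)) := fun j hj => by
      rw [hk j hj]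
      simp only [RamState.assign_var, if_neg (hxu _)]
    have hk0 := hk' 0 (by norm_num)
    have hk1 := hk' 1 (by norm_num)
    have hk2 := hk' 2 (by norm_num)
    have hk3 := hk' 3 (by norm_num)
    rw [Nat.add_zero] at hk0
    have hr3 := runs_add (tmp (t + 1)) (tmp (t + 1)) (tmp (t + 2)) s'
    rw [hk1, hk2, h2, h3] at hr3
    have hr4 := runs_sub (tmp t) (tmp t) (tmp (t + 2)) (s'.assign (tmp (t + 1)) (i + 1))
    refine ⟨_, (hr1.seq (hr2.seq (hr3.seq hr4))).mono (by omega),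
      hassign _ _ _ _ (hassign _ _ _ _ hIs' (.inr ⟨_, by omega, rfl⟩)) (.inr ⟨_, le_rfl, rfl⟩), ?_⟩
    simp only [RamState.assign_var, hn, hn1, hn2]
    norm_num
    rw [hk0, hk2, hk3, h1, h3, h4]
    refine ⟨by omega, rfl, rfl⟩

/-! ### Expressions and their compilation -/

/-- Expressions. The variables are bound by sums and by the loops of a program; `sum x e` is the sum
of the values of `e` for `x < L`, where `L` is the length of the input. -/
inductive Expr where
  | var (x : ℕ)
  | lit (c : ℕ)
  | add (e f : Expr)
  | sub (e f : Expr)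
  | get (a : ℕ) (e : Expr)
  | ite (c e f : Expr)
  | sum (x : ℕ) (e : Expr)

/-- The value of an expression, with the contents `a` of the arrays. -/
def Expr.eval (L : ℕ) (a : ℕ → ℕ → ℕ) : Expr → (ℕ → ℕ) → ℕ
  | .var x, v => v x
  | .lit c, _ => c
  | .add e f, v => e.eval L a v + f.eval L a v
  | .sub e f, v => e.eval L a v - f.eval L a v
  | .get k e, v => a k (e.eval L a v)
  | .ite c e f, v => if c.eval L a v ≠ 0 then e.eval L a v else f.eval L a v
  | .sum x e, v => ∑ i ∈ Finset.range L, e.eval L a (Function.update v x i)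

/-- Compute an expression into the temporary register `t`. The arrays of the source language are the
arrays with even numbers. -/
def Expr.code : Expr → ℕ → Ram
  | .var x, t => copyCode (tmp t) (usr x)
  | .lit c, t => .const (tmp t) c
  | .add e f, t => .seq (e.code t) (.seq (f.code (t + 1)) (.add (tmp t) (tmp t) (tmp (t + 1))))
  | .sub e f, t => .seq (e.code t) (.seq (f.code (t + 1)) (.sub (tmp t) (tmp t) (tmp (t + 1))))
  | .get k e, t => .seq (e.code t) (.read (tmp t) (2 * k) (tmp t))
  | .ite c e f, t => .seq (c.code t) (.cond (tmp t) (e.code t) (f.code t))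
  | .sum x e, t => .seq (.const (tmp t) 0)
      (forCode (t + 1) x (.seq (e.code (t + 5)) (.add (tmp t) (tmp t) (tmp (t + 5)))))

open Polynomial in
/-- A bound for the time to compute an expression, in terms of the length of the input. -/
def Expr.time : Expr → Polynomial ℕ
  | .var _ => 2
  | .lit _ => 1
  | .add e f => e.time + f.time + 1
  | .sub e f => e.time + f.time + 1
  | .get _ e => e.time + 1
  | .ite c e f => c.time + e.time + f.time + 1
  | .sum _ e => X * (e.time + 6) + 10

/-- The state `s` holds the input length `L`, the variables `v` and the arrays `a`. -/
structure Holds (L : ℕ) (v : ℕ → ℕ) (a : ℕ → ℕ → ℕ) (s : RamState) : Prop where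
  len : s.var 0 = L
  var : ∀ x, s.var (usr x) = v x
  arr : ∀ k, s.arr (2 * k) = a k

theorem SameUpTo.refl (t : ℕ) (s : RamState) : SameUpTo t s s := ⟨rfl, rfl, fun _ _ => rfl⟩

theorem SameUpTo.trans {t u : ℕ} {s₁ s₂ s₃ : RamState} (h : SameUpTo t s₁ s₂)
    (h' : SameUpTo u s₂ s₃) (hu : t ≤ u) : SameUpTo t s₁ s₃ :=
  ⟨h'.arr.trans h.arr, h'.out.trans h.out, fun k hk =>
    (h'.var k fun j hj => hk j (hu.trans hj)).trans (h.var k hk)⟩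

theorem SameUpTo.assign {t u : ℕ} {s s' : RamState} (h : SameUpTo t s s') (hu : t ≤ u) (c : ℕ) :
    SameUpTo t s (s'.assign (tmp u) c) :=
  ⟨h.arr, h.out, fun k hk => by rw [RamState.assign_var, if_neg (hk u hu), h.var k hk]⟩

theorem SameUpTo.tmp {t j : ℕ} {s s' : RamState} (h : SameUpTo t s s') (hj : j < t) :
    s'.var (tmp j) = s.var (tmp j) :=
  h.var _ fun i hi => by unfold _root_.tmp; omega

theorem SameUpTo.holds {t L : ℕ} {v : ℕ → ℕ} {a : ℕ → ℕ → ℕ} {s s' : RamState}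
    (h : SameUpTo t s s') (hs : Holds L v a s) : Holds L v a s' :=
  ⟨(h.var 0 fun j _ => by unfold _root_.tmp; omega).trans hs.len,
    fun x => (h.var _ fun j _ => by unfold _root_.tmp usr; omega).trans (hs.var x),
    fun k => by rw [h.arr, hs.arr]⟩

theorem tmp_inj {i j : ℕ} : tmp i = tmp j ↔ i = j := by unfold tmp; omega

theorem Expr.exists_runs_code (L : ℕ) (a : ℕ → ℕ → ℕ) (e : Expr) (t : ℕ) (v : ℕ → ℕ)
    (s : RamState) (hs : Holds L v a s) : ∃ s', Runs (e.code t) s s' (e.time.eval L) ∧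
      SameUpTo t s s' ∧ s'.var (tmp t) = e.eval L a v := by
  induction e generalizing t v s with
  | var x =>
    refine ⟨_, (runs_copy (by unfold usr tmp; omega) s).mono (by simp [Expr.time]),
      ((SameUpTo.refl t s).assign le_rfl _).assign le_rfl _, ?_⟩
    rw [RamState.assign_var, if_pos rfl, hs.var]
    rfl
  | lit c =>
    refine ⟨_, (runs_const _ c s).mono (by simp [Expr.time]),
      (SameUpTo.refl t s).assign le_rfl _, ?_⟩
    rw [RamState.assign_var, if_pos rfl]
    rfl
  | add e f ihe ihf =>
    obtain ⟨s₁, hr1, hs1, hv1⟩ := ihe t v s hs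
    obtain ⟨s₂, hr2, hs2, hv2⟩ := ihf (t + 1) v s₁ (hs1.holds hs)
    have hr3 := runs_add (tmp t) (tmp t) (tmp (t + 1)) s₂
    refine ⟨_, (hr1.seq (hr2.seq hr3)).mono (by simp [Expr.time]; omega),
      (hs1.trans hs2 (by omega)).assign le_rfl _, ?_⟩
    rw [RamState.assign_var, if_pos rfl, hv2, hs2.tmp (by omega), hv1]
    rfl
  | sub e f ihe ihf =>
    obtain ⟨s₁, hr1, hs1, hv1⟩ := ihe t v s hs
    obtain ⟨s₂, hr2, hs2, hv2⟩ := ihf (t + 1) v s₁ (hs1.holds hs)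
    have hr3 := runs_sub (tmp t) (tmp t) (tmp (t + 1)) s₂
    refine ⟨_, (hr1.seq (hr2.seq hr3)).mono (by simp [Expr.time]; omega),
      (hs1.trans hs2 (by omega)).assign le_rfl _, ?_⟩
    rw [RamState.assign_var, if_pos rfl, hv2, hs2.tmp (by omega), hv1]
    rfl
  | get k e ih =>
    obtain ⟨s₁, hr1, hs1, hv1⟩ := ih t v s hs
    refine ⟨_, (hr1.seq (runs_read (tmp t) (2 * k) (tmp t) s₁)).mono (by simp [Expr.time]),
      hs1.assign le_rfl _, ?_⟩
    rw [RamState.assign_var, if_pos rfl, hv1, hs1.arr, hs.arr]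
    rfl
  | ite c e f ihc ihe ihf =>
    obtain ⟨s₁, hr1, hs1, hv1⟩ := ihc t v s hs
    by_cases hc : c.eval L a v ≠ 0
    · obtain ⟨s₂, hr2, hs2, hv2⟩ := ihe t v s₁ (hs1.holds hs)
      refine ⟨s₂, (hr1.seq (Runs.cond (T := e.time.eval L) ?_)).mono (by simp [Expr.time]; omega),
        hs1.trans hs2 le_rfl, ?_⟩
      · rwa [hv1, if_pos hc]
      · rw [hv2, Expr.eval, if_pos hc]
    · obtain ⟨s₂, hr2, hs2, hv2⟩ := ihf t v s₁ (hs1.holds hs)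
      refine ⟨s₂, (hr1.seq (Runs.cond (T := f.time.eval L) ?_)).mono (by simp [Expr.time]; omega),
        hs1.trans hs2 le_rfl, ?_⟩
      · rwa [hv1, if_neg hc]
      · rw [hv2, Expr.eval, if_neg hc]
  | sum x e ih =>
    have hux : ∀ j, tmp j ≠ usr x := fun j => by unfold usr tmp; omega
    -- The accumulator holds the partial sums.
    obtain ⟨s', hr, ⟨hI1, hI2, hI3, hI4⟩, hx⟩ := exists_runs_forCode (t := t + 1) (x := x)
      (T := e.time.eval L + 1) (L := L)
      (p := .seq (e.code (t + 5)) (.add (tmp t) (tmp t) (tmp (t + 5))))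
      (fun i s' => s'.arr = s.arr ∧ s'.out = s.out ∧
        (∀ k, k ≠ usr x → (∀ j, t ≤ j → k ≠ tmp j) → s'.var k = s.var k) ∧
        s'.var (tmp t) = ∑ j ∈ Finset.range i, e.eval L a (Function.update v x j))
      (by
        rintro i s₁ s₂ ⟨h1, h2, h3, h4⟩ g1 g2 g3
        refine ⟨g1.trans h1, g2.trans h2, fun k hk hk' => ?_, ?_⟩
        · rw [g3 k hk fun j hj => hk' j (by omega), h3 k hk hk']
        · rw [g3 _ (hux t) fun j hj => by unfold tmp; omega, h4])
      (by
        rintro i s₁ ⟨-, -, h3, -⟩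
        rw [h3 0 (by unfold usr; omega) fun j _ => by unfold tmp; omega, hs.len])
      (by
        rintro i - s₁ ⟨h1, h2, h3, h4⟩ hxi
        have hh : Holds L (Function.update v x i) a s₁ := by
          refine ⟨?_, fun y => ?_, fun k => by rw [h1, hs.arr]⟩
          · rw [h3 0 (by unfold usr; omega) fun j _ => by unfold tmp; omega, hs.len]
          · rcases eq_or_ne y x with rfl | hy
            · rw [hxi, Function.update_self]
            · rw [h3 _ (by unfold usr; omega) fun j _ => by unfold tmp usr; omega, hs.var,
                Function.update_of_ne hy]
        obtain ⟨s₂, hr2, hs2, hv2⟩ := ih (t + 5) _ s₁ hh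
        refine ⟨_, hr2.seq (runs_add (tmp t) (tmp t) (tmp (t + 5)) s₂),
          ⟨hs2.arr.trans h1, hs2.out.trans h2, fun k hk hk' => ?_, ?_⟩, fun j hj => ?_⟩
        · rw [RamState.assign_var, if_neg (hk' t le_rfl), hs2.var k fun j hj => hk' j (by omega),
            h3 k hk hk']
        · rw [RamState.assign_var, if_pos rfl, hv2, hs2.tmp (by omega), h4, Finset.sum_range_succ]
        · rw [RamState.assign_var, if_neg (by rw [tmp_inj]; omega), hs2.tmp (by omega)])
      (s := s.assign (tmp t) 0)
      ⟨rfl, rfl, fun k _ hk => by rw [RamState.assign_var, if_neg (hk t le_rfl)], by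
        rw [RamState.assign_var, if_pos rfl, Finset.sum_range_zero]⟩
    refine ⟨s', ((runs_const _ 0 s).seq hr).mono ?_, ⟨hI1, hI2, fun k hk => ?_⟩, hI4⟩
    · simp only [Expr.time, Polynomial.eval_add, Polynomial.eval_mul, Polynomial.eval_X,
        Polynomial.eval_ofNat]
      apply le_of_eq
      ring
    · rcases eq_or_ne k (usr x) with rfl | hkx
      · rw [hx, RamState.assign_var, if_neg (hux t).symm]
      · exact hI3 k hkx hk

/-! ### Programs and their compilation -/

/-- Programs of the source language. `fill k x e` sets entry `x` of array `k` to the value of `e` for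
all `x < L` simultaneously; `loop x p` runs `p` for `x = 0, …, L - 1`. -/
inductive Prog where
  | fill (k x : ℕ) (e : Expr)
  | emit (e : Expr)
  | seq (p q : Prog)
  | cond (e : Expr) (p : Prog)
  | loop (x : ℕ) (p : Prog)

/-- The effect of a program on the arrays and the output. -/
def Prog.run (L : ℕ) : Prog → (ℕ → ℕ) → (ℕ → ℕ → ℕ) × List ℕ → (ℕ → ℕ → ℕ) × List ℕ
  | .fill k x e, v, σ => (Function.update σ.1 k fun i =>
      if i < L then e.eval L σ.1 (Function.update v x i) else σ.1 k i, σ.2)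
  | .emit e, v, σ => (σ.1, σ.2 ++ [e.eval L σ.1 v])
  | .seq p q, v, σ => q.run L v (p.run L v σ)
  | .cond e p, v, σ => if e.eval L σ.1 v ≠ 0 then p.run L v σ else σ
  | .loop x p, v, σ => Nat.rec σ (fun i τ => p.run L (Function.update v x i) τ) L

/-- The machine program. The values of a `fill` are collected in array `1` before they are copied to
their place. -/
def Prog.code : Prog → ℕ → Ram
  | .fill k x e, t => .seq
      (forCode t x (.seq (e.code (t + 4)) (.write 1 (usr x) (tmp (t + 4)))))
      (forCode t x (.seq (.read (tmp (t + 4)) 1 (usr x)) (.write (2 * k) (usr x) (tmp (t + 4)))))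
  | .emit e, t => .seq (e.code t) (.emit (tmp t))
  | .seq p q, t => .seq (p.code t) (q.code t)
  | .cond e p, t => .seq (e.code t) (.cond (tmp t) (p.code t) (.const (tmp t) 0))
  | .loop x p, t => forCode t x (p.code (t + 4))

open Polynomial in
/-- A bound for the running time, in terms of the length of the input. -/
def Prog.time : Prog → Polynomial ℕ
  | .fill _ _ e => X * (e.time + 6) + 9 + (X * 7 + 9)
  | .emit e => e.time + 1
  | .seq p q => p.time + q.time
  | .cond e p => e.time + (p.time + 1 + 1)
  | .loop _ p => X * (p.time + 5) + 9

theorem Holds.update {L : ℕ} {v : ℕ → ℕ} {a : ℕ → ℕ → ℕ} {s : RamState} {x i : ℕ}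
    (hlen : s.var 0 = L) (hvar : ∀ y, y ≠ x → s.var (usr y) = v y)
    (harr : ∀ k, s.arr (2 * k) = a k) (hx : s.var (usr x) = i) :
    Holds L (Function.update v x i) a s := by
  refine ⟨hlen, fun y => ?_, harr⟩
  rcases eq_or_ne y x with rfl | hy
  · rw [hx, Function.update_self]
  · rw [hvar y hy, Function.update_of_ne hy]

theorem Prog.exists_runs_code (L : ℕ) (p : Prog) (t : ℕ) (v : ℕ → ℕ)
    (σ : (ℕ → ℕ → ℕ) × List ℕ) (s : RamState) (hs : Holds L v σ.1 s) (ho : s.out = σ.2) :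
    ∃ s', Runs (p.code t) s s' (p.time.eval L) ∧ (∀ k, s'.arr (2 * k) = (p.run L v σ).1 k) ∧
      s'.out = (p.run L v σ).2 ∧ ∀ k, (∀ j, t ≤ j → k ≠ tmp j) → s'.var k = s.var k := by
  have hux : ∀ x j, tmp j ≠ usr x := fun x j => by unfold usr tmp; omega
  have hu0 : ∀ x, 0 ≠ usr x := fun x => by unfold usr; omega
  have ht0 : ∀ j, 0 ≠ tmp j := fun x => by unfold tmp; omega
  have huu : ∀ x y, y ≠ x → usr y ≠ usr x := fun x y h => by unfold usr; omega
  induction p generalizing t v σ s with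
  | fill k x e =>
    have hframe : ∀ {s' : RamState}, (∀ k, k ≠ usr x → (∀ j, t ≤ j → k ≠ tmp j) →
        s'.var k = s.var k) → s'.var 0 = L ∧ ∀ y, y ≠ x → s'.var (usr y) = v y := by
      intro s' h
      refine ⟨?_, fun y hy => ?_⟩
      · rw [h 0 (hu0 x) fun j _ => ht0 j, hs.len]
      · rw [h _ (huu x y hy) fun j _ => (hux y j).symm, hs.var]
    obtain ⟨s₁, hr1, ⟨hI1, hI2, hI3, hI4⟩, hx1⟩ := exists_runs_forCode (t := t) (x := x)
      (T := e.time.eval L + 1) (L := L)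
      (p := .seq (e.code (t + 4)) (.write 1 (usr x) (tmp (t + 4))))
      (fun i s' => (∀ k, s'.arr (2 * k) = σ.1 k) ∧ s'.out = σ.2 ∧
        (∀ k, k ≠ usr x → (∀ j, t ≤ j → k ≠ tmp j) → s'.var k = s.var k) ∧
        ∀ j < i, s'.arr 1 j = e.eval L σ.1 (Function.update v x j))
      (by
        rintro i s₁ s₂ ⟨h1, h2, h3, h4⟩ g1 g2 g3
        rw [g1, g2]
        exact ⟨h1, h2, fun k hk hk' => by rw [g3 k hk hk', h3 k hk hk'], h4⟩)
      (fun i s₁ h => (hframe h.2.2.1).1)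
      (by
        rintro i - s₁ ⟨h1, h2, h3, h4⟩ hxi
        have hh : Holds L (Function.update v x i) σ.1 s₁ :=
          .update (hframe h3).1 (hframe h3).2 h1 hxi
        obtain ⟨s₂, hr2, hs2, hv2⟩ := e.exists_runs_code L σ.1 (t + 4) _ s₁ hh
        have hxi2 : s₂.var (usr x) = i := by
          rw [hs2.var _ fun j _ => (hux x j).symm, hxi]
        refine ⟨_, hr2.seq ⟨1, le_rfl, .write 1 (usr x) (tmp (t + 4)) s₂⟩,
          ⟨fun k => ?_, hs2.out.trans h2, fun k hk hk' => ?_, fun j hj => ?_⟩, fun j hj =>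
            hs2.tmp (by omega)⟩
        · simp only
          rw [Function.update_of_ne (by omega), hs2.arr, h1]
        · exact (hs2.var k fun j hj => hk' j (by omega)).trans (h3 k hk hk')
        · simp only [Function.update_self]
          rw [hxi2, hv2]
          rcases Nat.lt_succ_iff_lt_or_eq.1 hj with h | rfl
          · rw [Function.update_of_ne h.ne, hs2.arr, h4 j h]
          · rw [Function.update_self])
      (s := s) ⟨hs.arr, ho, fun _ _ _ => rfl, fun j hj => absurd hj (Nat.not_lt_zero j)⟩
    obtain ⟨s₂, hr2, ⟨hJ1, hJ2, hJ3, hJ4, hJ5⟩, hx2⟩ := exists_runs_forCode (t := t) (x := x)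
      (T := 2) (L := L)
      (p := .seq (.read (tmp (t + 4)) 1 (usr x)) (.write (2 * k) (usr x) (tmp (t + 4))))
      (fun i s' => (∀ l, l ≠ k → s'.arr (2 * l) = σ.1 l) ∧ s'.out = σ.2 ∧
        (∀ k, k ≠ usr x → (∀ j, t ≤ j → k ≠ tmp j) → s'.var k = s.var k) ∧
        s'.arr 1 = s₁.arr 1 ∧
        ∀ j, s'.arr (2 * k) j = if j < i then s₁.arr 1 j else σ.1 k j)
      (by
        rintro i s₁ s₂ ⟨h1, h2, h3, h4, h5⟩ g1 g2 g3
        rw [g1, g2]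
        exact ⟨h1, h2, fun k hk hk' => by rw [g3 k hk hk', h3 k hk hk'], h4, h5⟩)
      (fun i s₁ h => (hframe h.2.2.1).1)
      (by
        rintro i - s₂ ⟨h1, h2, h3, h4, h5⟩ hxi
        have hxi2 : (s₂.assign (tmp (t + 4)) (s₁.arr 1 i)).var (usr x) = i := by
          rw [RamState.assign_var, if_neg (hux x _).symm, hxi]
        have hr1 := runs_read (tmp (t + 4)) 1 (usr x) s₂
        rw [h4, hxi] at hr1
        refine ⟨_, hr1.seq ⟨1, le_rfl, .write (2 * k) (usr x) (tmp (t + 4)) _⟩,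
          ⟨fun l hl => ?_, h2, fun l hl hl' => ?_, ?_, fun j => ?_⟩, fun j hj => ?_⟩
        · simp only
          rw [Function.update_of_ne (by omega), RamState.assign_arr, h1 l hl]
        · simp only
          rw [RamState.assign_var, if_neg (hl' _ (by omega)), h3 l hl hl']
        · simp only
          rw [Function.update_of_ne (by omega), RamState.assign_arr, h4]
        · simp only [Function.update_self]
          rw [hxi2, RamState.assign_var, if_pos rfl, RamState.assign_arr, Function.update_apply,
            h5 j]
          rcases lt_trichotomy j i with h | rfl | h
          · rw [if_neg h.ne, if_pos h, if_pos (by omega)]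
          · rw [if_pos rfl, if_pos (by omega)]
          · rw [if_neg h.ne', if_neg (by omega), if_neg (by omega)]
        · simp only
          rw [RamState.assign_var, if_neg (by rw [tmp_inj]; omega)])
      (s := s₁) ⟨fun l _ => hI1 l, hI2, hI3, rfl, fun j => by
        rw [if_neg (Nat.not_lt_zero j), hI1]⟩
    refine ⟨s₂, (hr1.seq hr2).mono (by simp [Prog.time, add_assoc]), fun l => ?_, hJ2,
      fun l hl => ?_⟩
    · rcases eq_or_ne l k with rfl | hl
      · simp only [Prog.run, Function.update_self]
        funext j
        rw [hJ5 j]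
        split_ifs with hj
        · exact hI4 j hj
        · rfl
      · simp only [Prog.run, Function.update_of_ne hl, hJ1 l hl]
    · rcases eq_or_ne l (usr x) with rfl | hlx
      · rw [hx2, hx1]
      · exact hJ3 l hlx hl
  | emit e =>
    obtain ⟨s₁, hr1, hs1, hv1⟩ := e.exists_runs_code L σ.1 t v s hs
    refine ⟨_, (hr1.seq ⟨1, le_rfl, .emit (tmp t) s₁⟩).mono (by simp [Prog.time]), fun k => ?_, ?_,
      fun k hk => ?_⟩
    · simp only
      rw [hs1.arr, hs.arr]
      rfl
    · simp only
      rw [hv1, hs1.out, ho]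
      rfl
    · exact hs1.var k hk
  | seq p q ihp ihq =>
    obtain ⟨s₁, hr1, ha1, ho1, hv1⟩ := ihp t v σ s hs ho
    obtain ⟨s₂, hr2, ha2, ho2, hv2⟩ := ihq t v (p.run L v σ) s₁
      ⟨by rw [hv1 0 fun j _ => ht0 j, hs.len],
        fun x => by rw [hv1 _ fun j _ => (hux x j).symm, hs.var], ha1⟩ ho1
    exact ⟨s₂, (hr1.seq hr2).mono (by simp [Prog.time]), ha2, ho2, fun k hk => by
      rw [hv2 k hk, hv1 k hk]⟩
  | cond e p ih =>
    obtain ⟨s₁, hr1, hs1, hv1⟩ := e.exists_runs_code L σ.1 t v s hs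
    by_cases hc : e.eval L σ.1 v ≠ 0
    · obtain ⟨s₂, hr2, ha2, ho2, hv2⟩ := ih t v σ s₁ (hs1.holds hs) (hs1.out.trans ho)
      refine ⟨s₂, (hr1.seq (Runs.cond (T := p.time.eval L) ?_)).mono (by simp [Prog.time]),
        ?_, ?_, fun k hk => by rw [hv2 k hk, hs1.var k hk]⟩
      · rwa [hv1, if_pos hc]
      · rwa [Prog.run, if_pos hc]
      · rwa [Prog.run, if_pos hc]
    · refine ⟨s₁.assign (tmp t) 0, (hr1.seq (Runs.cond (T := 1) ?_)).mono
        (by simp [Prog.time]), ?_, ?_, fun k hk => ?_⟩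
      · rw [hv1, if_neg hc]
        exact runs_const _ _ _
      · rw [Prog.run, if_neg hc]
        intro k
        rw [RamState.assign_arr, hs1.arr, hs.arr]
      · rw [Prog.run, if_neg hc, RamState.assign_out, hs1.out, ho]
      · rw [RamState.assign_var, if_neg (hk t le_rfl), hs1.var k hk]
  | loop x p ih =>
    set τ : ℕ → (ℕ → ℕ → ℕ) × List ℕ := fun i =>
      Nat.rec σ (fun i τ => p.run L (Function.update v x i) τ) i with hτ
    have hframe : ∀ {s' : RamState}, (∀ k, k ≠ usr x → (∀ j, t ≤ j → k ≠ tmp j) →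
        s'.var k = s.var k) → s'.var 0 = L ∧ ∀ y, y ≠ x → s'.var (usr y) = v y := by
      intro s' h
      refine ⟨?_, fun y hy => ?_⟩
      · rw [h 0 (hu0 x) fun j _ => ht0 j, hs.len]
      · rw [h _ (huu x y hy) fun j _ => (hux y j).symm, hs.var]
    obtain ⟨s₁, hr1, ⟨hI1, hI2, hI3⟩, hx1⟩ := exists_runs_forCode (t := t) (x := x)
      (T := p.time.eval L) (L := L) (p := p.code (t + 4))
      (fun i s' => (∀ k, s'.arr (2 * k) = (τ i).1 k) ∧ s'.out = (τ i).2 ∧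
        (∀ k, k ≠ usr x → (∀ j, t ≤ j → k ≠ tmp j) → s'.var k = s.var k))
      (by
        rintro i s₁ s₂ ⟨h1, h2, h3⟩ g1 g2 g3
        rw [g1, g2]
        exact ⟨h1, h2, fun k hk hk' => by rw [g3 k hk hk', h3 k hk hk']⟩)
      (fun i s₁ h => (hframe h.2.2).1)
      (by
        rintro i - s₁ ⟨h1, h2, h3⟩ hxi
        obtain ⟨s₂, hr2, ha2, ho2, hv2⟩ := ih (t + 4) (Function.update v x i) (τ i) s₁
          (.update (hframe h3).1 (hframe h3).2 h1 hxi) h2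
        refine ⟨s₂, hr2, ⟨ha2, ho2, fun k hk hk' => ?_⟩, fun j hj =>
          hv2 _ fun i hi => by rw [Ne, tmp_inj]; omega⟩
        rw [hv2 k fun j hj => hk' j (by omega), h3 k hk hk'])
      (s := s) ⟨hs.arr, ho, fun _ _ _ => rfl⟩
    refine ⟨s₁, hr1.mono (by simp [Prog.time]), hI1, hI2, fun k hk => ?_⟩
    rcases eq_or_ne k (usr x) with rfl | hkx
    · exact hx1
    · exact hI3 k hkx hk

theorem polynomial_eval_mono (q : Polynomial ℕ) {m n : ℕ} (h : m ≤ n) : q.eval m ≤ q.eval n := by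
  rw [Polynomial.eval_eq_sum, Polynomial.eval_eq_sum]
  exact Finset.sum_le_sum fun i _ => Nat.mul_le_mul_left _ (Nat.pow_le_pow_left h i)

theorem length_le_bitLength (w : List ℕ) : w.length ≤ bitLength w := by
  induction w with
  | nil => simp
  | cons a w ih =>
    simp only [bitLength, List.map_cons, List.sum_cons, List.length_cons] at ih ⊢
    omega

/-- The arrays at the start: array `0` holds the input. -/
def inputArrays (w : List ℕ) : ℕ → ℕ → ℕ := fun k i => if k = 0 then w.getD i 0 else 0

/-- Every function computed by a program of the source language is computable in polynomial time. -/
theorem polyTime_of_run {A : Type*} {inp out : A → List ℕ} (p : Prog)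
    (h : ∀ x, (p.run (inp x).length (fun _ => 0) (inputArrays (inp x), [])).2 = out x) :
    PolyTime inp out := by
  refine ⟨p.code 0, p.time, fun x => ?_⟩
  obtain ⟨s, ⟨t, ht, hr⟩, -, ho, -⟩ := p.exists_runs_code (inp x).length 0 (fun _ => 0)
    (inputArrays (inp x), []) (ramInput (inp x))
    ⟨rfl, fun y => by simp [ramInput, usr], fun k => by
      funext i
      rcases eq_or_ne k 0 with rfl | hk
      · rfl
      · simp [ramInput, inputArrays, hk]⟩ rfl
  exact ⟨s, t, hr, ho.trans (h x), ht.trans (polynomial_eval_mono _ (length_le_bitLength _))⟩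

/-! ### Boolean expressions and counting -/

section Macros

/-- The comparison `e < f`. Truth values are zero and nonzero. -/
def Expr.lt (e f : Expr) : Expr := .sub f e

/-- The comparison `e ≤ f`. -/
def Expr.le (e f : Expr) : Expr := .sub (.add f (.lit 1)) e

/-- Conjunction. -/
def Expr.and (e f : Expr) : Expr := .ite e f (.lit 0)

/-- Disjunction. -/
def Expr.or (e f : Expr) : Expr := .ite e (.lit 1) f

/-- Negation. -/
def Expr.not (e : Expr) : Expr := .ite e (.lit 0) (.lit 1)

/-- The comparison `e = f`. -/
def Expr.eq (e f : Expr) : Expr := .and (.le e f) (.le f e)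

/-- The number of `x < b` with `P`. -/
def Expr.count (x : ℕ) (b P : Expr) : Expr :=
  .sum x (.ite (.lt (.var x) b) (.ite P (.lit 1) (.lit 0)) (.lit 0))

variable {L : ℕ} {a : ℕ → ℕ → ℕ} {v : ℕ → ℕ} {e f : Expr}

theorem Expr.eval_ite {c : Expr} : (Expr.ite c e f).eval L a v =
    if c.eval L a v ≠ 0 then e.eval L a v else f.eval L a v := rfl

theorem Expr.eval_sub : (Expr.sub e f).eval L a v = e.eval L a v - f.eval L a v := rfl

theorem Expr.lt_ne : (Expr.lt e f).eval L a v ≠ 0 ↔ e.eval L a v < f.eval L a v := by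
  simp only [Expr.lt, Expr.eval]
  omega

theorem Expr.le_ne : (Expr.le e f).eval L a v ≠ 0 ↔ e.eval L a v ≤ f.eval L a v := by
  simp only [Expr.le, Expr.eval]
  omega

theorem Expr.and_ne : (Expr.and e f).eval L a v ≠ 0 ↔ e.eval L a v ≠ 0 ∧ f.eval L a v ≠ 0 := by
  simp only [Expr.and, Expr.eval]
  split_ifs with h
  · simp [h]
  · simp [h]

theorem Expr.or_ne : (Expr.or e f).eval L a v ≠ 0 ↔ e.eval L a v ≠ 0 ∨ f.eval L a v ≠ 0 := by
  simp only [Expr.or, Expr.eval]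
  split_ifs with h
  · simp [h]
  · simp [h]

theorem Expr.not_ne : (Expr.not e).eval L a v ≠ 0 ↔ ¬ e.eval L a v ≠ 0 := by
  simp only [Expr.not, Expr.eval]
  split_ifs with h
  · simp [h]
  · simp [h]

theorem Expr.eq_ne : (Expr.eq e f).eval L a v ≠ 0 ↔ e.eval L a v = f.eval L a v := by
  rw [Expr.eq, Expr.and_ne, Expr.le_ne, Expr.le_ne]
  omega

theorem Expr.sum_ne {x : ℕ} : (Expr.sum x e).eval L a v ≠ 0 ↔
    ∃ i < L, e.eval L a (Function.update v x i) ≠ 0 := by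
  simp only [Expr.eval, ne_eq, Finset.sum_eq_zero_iff, Finset.mem_range, not_forall, exists_prop]

theorem Expr.eval_count {x M : ℕ} {b P : Expr} {Q : ℕ → Prop} [DecidablePred Q]
    (hb : ∀ i, b.eval L a (Function.update v x i) = M) (hM : M ≤ L)
    (hQ : ∀ i < M, P.eval L a (Function.update v x i) ≠ 0 ↔ Q i) :
    (Expr.count x b P).eval L a v = ((Finset.range M).filter Q).card := by
  rw [Finset.card_filter, Expr.count, Expr.eval]
  refine (Finset.sum_subset (Finset.range_mono hM) fun i _ hi => ?_).symm.trans
    (Finset.sum_congr rfl fun i hi => ?_)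
  · rw [Expr.eval, if_neg]
    · rfl
    rw [Expr.lt_ne, hb]
    simpa [Expr.eval] using hi
  · have hi' := Finset.mem_range.1 hi
    rw [Expr.eval, if_pos]
    · simp only [Expr.eval, hQ i hi']
    rw [Expr.lt_ne, hb]
    simpa [Expr.eval] using hi'

end Macros

/-! ### Expressions for one coarsening step -/

/-- The arrays `0`, `1` and `6` describe a graph `G` with at most `n` vertices: its adjacency matrix
with rows of length `n`, its number of vertices, and the multiples of `n`. -/
structure HoldsGraph (L n : ℕ) (G : FinGraph) (a : ℕ → ℕ → ℕ) : Prop where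
  len : L = 1 + n * n
  le : G.n ≤ n
  stride : a 0 0 = n
  adj : ∀ u < G.n, ∀ v < G.n, a 0 (1 + (u * n + v)) ≠ 0 ↔ G.adj u v
  card : a 1 0 = G.n
  row : ∀ i < L, a 6 i = i * n

theorem HoldsGraph.n_lt {L n : ℕ} {G : FinGraph} {a : ℕ → ℕ → ℕ} (h : HoldsGraph L n G a) :
    n < L := by
  have := h.len
  nlinarith [Nat.zero_le (n - 1), Nat.le_mul_self n]

theorem HoldsGraph.lt {L n : ℕ} {G : FinGraph} {a : ℕ → ℕ → ℕ} (h : HoldsGraph L n G a) :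
    G.n < L := h.le.trans_lt h.n_lt

theorem HoldsGraph.congr {L n : ℕ} {G : FinGraph} {a b : ℕ → ℕ → ℕ} (h : HoldsGraph L n G a)
    (h0 : b 0 = a 0) (h1 : b 1 = a 1) (h6 : b 6 = a 6) : HoldsGraph L n G b :=
  ⟨h.len, h.le, by rw [h0, h.stride], by rw [h0]; exact h.adj, by rw [h1, h.card],
    by rw [h6]; exact h.row⟩

/-- The number of vertices of the current graph. -/
def cardE : Expr := .get 1 (.lit 0)

/-- Adjacency in the current graph. -/
def adjE (e f : Expr) : Expr :=
  .and (.lt e cardE) (.and (.lt f cardE) (.get 0 (.add (.lit 1) (.add (.get 6 e) f))))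

/-- Having a neighbour, given that array `7` holds the least neighbours. -/
def nonIsoE (e : Expr) : Expr := adjE e (.get 7 e)

/-- The number of elements of the fibre of `e` under the map in array `3`. -/
def fibreCardE (e : Expr) : Expr := .count 2 cardE (.eq (.get 3 (.var 2)) (.get 3 e))

/-- The number of elements of the fibre of variable `0` that are smaller than it. -/
def fibreRankE : Expr := .count 2 cardE
  (.and (.lt (.var 2) (.var 0)) (.eq (.get 3 (.var 2)) (.get 3 (.var 0))))

/-- The least neighbour is the number of vertices with no neighbour up to them. -/
def nbE : Expr := .count 2 cardE
  (.not (.count 3 cardE (.and (.le (.var 3) (.var 2)) (adjE (.var 0) (.var 3)))))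

/-- The new value at variable `0` of the star map when variable `1` is treated. -/
def starStepE : Expr :=
  .ite (.and (nonIsoE (.var 1)) (.le (fibreCardE (.var 1)) (.lit 1)))
    (.ite (.or (.eq (.var 0) (.var 1)) (.or (.eq (.var 0) (.get 7 (.var 1)))
        (.and (.eq (.var 0) (.get 3 (.get 7 (.var 1))))
          (.le (fibreCardE (.get 7 (.var 1))) (.lit 2)))))
      (.get 7 (.var 1)) (.get 3 (.var 0)))
    (.get 3 (.var 0))

/-- Whether variable `0` is a root. -/
def isRootE : Expr := .and (.sum 3 (.eq (.add (.var 3) (.var 3)) fibreRankE))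
  (.lt (.add fibreRankE (.lit 1)) (fibreCardE (.var 0)))

/-- The label of variable `0`, given that array `4` marks the roots. -/
def coarsenLabelE : Expr := .ite (nonIsoE (.var 0))
  (.sub (.count 2 cardE (.and (.get 4 (.var 2)) (.or (.lt (.get 3 (.var 2)) (.get 3 (.var 0)))
    (.and (.eq (.get 3 (.var 2)) (.get 3 (.var 0))) (.le (.var 2) (.var 0)))))) (.lit 1))
  (.add cardE (.var 0))

/-- Entry number `0` of the array that represents the coarsened graph. -/
def coarsenAdjE : Expr := .ite (.var 0)
  (.sum 1 (.sum 2 (.and (adjE (.var 1) (.var 2)) (.and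
    (.not (.eq (.get 5 (.var 1)) (.get 5 (.var 2))))
    (.eq (.var 0) (.add (.lit 1) (.add (.get 6 (.get 5 (.var 1))) (.get 5 (.var 2)))))))))
  (.get 0 (.lit 0))

section Eval

variable {L n : ℕ} {G : FinGraph} {a : ℕ → ℕ → ℕ} {v : ℕ → ℕ}

theorem HoldsGraph.eval_cardE (h : HoldsGraph L n G a) : cardE.eval L a v = G.n := h.card

theorem HoldsGraph.adjE_ne (h : HoldsGraph L n G a) {e f : Expr} :
    (adjE e f).eval L a v ≠ 0 ↔ G.adj (e.eval L a v) (f.eval L a v) := by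
  simp only [adjE, Expr.and_ne, Expr.lt_ne, h.eval_cardE]
  constructor
  · rintro ⟨h1, h2, h3⟩
    simp only [Expr.eval, h.row _ (h1.trans h.lt)] at h3
    exact (h.adj _ h1 _ h2).1 h3
  · intro hadj
    refine ⟨hadj.lt_left, hadj.lt_right, ?_⟩
    simp only [Expr.eval, h.row _ (hadj.lt_left.trans h.lt)]
    exact (h.adj _ hadj.lt_left _ hadj.lt_right).2 hadj

theorem HoldsGraph.nonIsoE_ne (h : HoldsGraph L n G a) (h7 : ∀ i, G.NonIso i → a 7 i = G.nb i)
    {e : Expr} : (nonIsoE e).eval L a v ≠ 0 ↔ G.NonIso (e.eval L a v) := by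
  rw [nonIsoE, h.adjE_ne]
  refine ⟨fun hadj => ⟨_, hadj⟩, fun hi => ?_⟩
  rw [Expr.eval, h7 _ hi]
  exact hi.adj_nb

theorem HoldsGraph.eval_fibreCardE (h : HoldsGraph L n G a) {p : ℕ → ℕ} (h3 : ∀ i < L, a 3 i = p i)
    {e : Expr} {x : ℕ} (he : ∀ i, e.eval L a (Function.update v 2 i) = x) (hx : x < L) :
    (fibreCardE e).eval L a v = fibreCard G.n p x := by
  refine Expr.eval_count (fun i => h.eval_cardE) h.lt.le fun i hi => ?_
  rw [Expr.eq_ne]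
  simp only [Expr.eval, he, Function.update_self]
  rw [h3 i (hi.trans h.lt), h3 x hx]

theorem HoldsGraph.eval_fibreRankE (h : HoldsGraph L n G a) {p : ℕ → ℕ} (h3 : ∀ i < L, a 3 i = p i)
    (hv : v 0 < L) : fibreRankE.eval L a v = fibreRank G.n p (v 0) := by
  refine Expr.eval_count (fun i => h.eval_cardE) h.lt.le fun i hi => ?_
  rw [Expr.and_ne, Expr.lt_ne, Expr.eq_ne]
  simp only [Expr.eval, Function.update_apply]
  norm_num only
  simp only [if_true, if_false]
  rw [h3 i (hi.trans h.lt), h3 _ hv]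

theorem HoldsGraph.eval_nbE (h : HoldsGraph L n G a) (hi : G.NonIso (v 0)) :
    nbE.eval L a v = G.nb (v 0) := by
  have hnb : G.nb (v 0) < G.n := hi.adj_nb.lt_right
  rw [nbE, Expr.eval_count (Q := fun j => j < G.nb (v 0)) (fun i => h.eval_cardE) h.lt.le]
  · have : (Finset.range G.n).filter (fun j => j < G.nb (v 0)) = Finset.range (G.nb (v 0)) := by
      ext j
      simp only [Finset.mem_filter, Finset.mem_range]
      omega
    rw [this, Finset.card_range]
  · classical
    intro j hj
    rw [Expr.not_ne, Expr.eval_count (Q := fun i => i ≤ j ∧ G.adj (v 0) i)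
      (fun i => h.eval_cardE) h.lt.le]
    · rw [not_not, Finset.card_eq_zero, Finset.filter_eq_empty_iff]
      constructor
      · intro hn
        by_contra hc
        exact hn (Finset.mem_range.2 hnb) ⟨not_lt.1 hc, hi.adj_nb⟩
      · rintro hlt i - ⟨hij, hadj⟩
        have : G.nb (v 0) ≤ i := Nat.sInf_le hadj
        omega
    · intro i hi
      rw [Expr.and_ne, Expr.le_ne, h.adjE_ne]
      simp only [Expr.eval, Function.update_apply]
      norm_num

theorem HoldsGraph.eval_starStepE (h : HoldsGraph L n G a) (h7 : ∀ i, G.NonIso i → a 7 i = G.nb i)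
    {p : ℕ → ℕ} (h3 : ∀ i < L, a 3 i = p i) (hv : v 0 < L) :
    starStepE.eval L a v = G.starStep p (v 1) (v 0) := by
  rw [starStepE, Expr.eval_ite, FinGraph.starStep]
  by_cases hi : G.NonIso (v 1)
  · have hv1 : v 1 < L := hi.lt.trans h.lt
    have hnb : G.nb (v 1) < L := hi.adj_nb.lt_right.trans h.lt
    have h71 := h7 _ hi
    have e1 : (fibreCardE (.var 1)).eval L a v = fibreCard G.n p (v 1) :=
      h.eval_fibreCardE h3 (fun i => by simp [Expr.eval]) hv1
    have e2 : (fibreCardE (.get 7 (.var 1))).eval L a v = fibreCard G.n p (G.nb (v 1)) :=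
      h.eval_fibreCardE h3 (fun i => by simp [Expr.eval, h71]) hnb
    have hc : (Expr.and (nonIsoE (.var 1)) (.le (fibreCardE (.var 1))
        (.lit 1))).eval L a v ≠ 0 ↔ G.NonIso (v 1) ∧ fibreCard G.n p (v 1) ≤ 1 := by
      rw [Expr.and_ne, h.nonIsoE_ne h7, Expr.le_ne, e1]
      rfl
    by_cases hc' : G.NonIso (v 1) ∧ fibreCard G.n p (v 1) ≤ 1
    · rw [if_pos (hc.2 hc'), if_pos hc', Expr.eval_ite]
      simp only [Expr.and_ne, Expr.le_ne, Expr.or_ne, Expr.eq_ne, e2]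
      simp only [Expr.eval, h71, h3 _ hv, h3 _ hnb]
    · rw [if_neg (mt hc.1 hc'), if_neg hc', Expr.eval, Expr.eval, h3 _ hv]
  · rw [if_neg, if_neg fun hc => hi hc.1]
    · rw [Expr.eval, Expr.eval, h3 _ hv]
    · rw [Expr.and_ne, h.nonIsoE_ne h7]
      exact fun hc => hi hc.1

theorem HoldsGraph.isRootE_ne (h : HoldsGraph L n G a) {p : ℕ → ℕ} (h3 : ∀ i < L, a 3 i = p i)
    (hv : v 0 < G.n) : isRootE.eval L a v ≠ 0 ↔ IsRoot G.n p (v 0) := by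
  have hvL := hv.trans h.lt
  rw [isRootE, Expr.and_ne, Expr.lt_ne, Expr.sum_ne, Expr.eval, h.eval_fibreRankE h3 hvL,
    h.eval_fibreCardE h3 (x := v 0) (fun i => by simp [Expr.eval]) hvL]
  refine and_congr ⟨?_, ?_⟩ Iff.rfl
  · rintro ⟨j, -, hj⟩
    rw [Expr.eq_ne, h.eval_fibreRankE h3 (by simpa [Function.update_apply] using hvL)] at hj
    simp only [Expr.eval, Function.update_apply] at hj
    exact ⟨j, by simpa using hj.symm⟩
  · rintro ⟨j, hj⟩
    have h1 := (fibreRank_lt_fibreCard (p := p) hv).le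
    have h2 : fibreCard G.n p (v 0) ≤ G.n :=
      (Finset.card_filter_le _ _).trans_eq (Finset.card_range _)
    have h4 := h.lt
    refine ⟨j, by omega, ?_⟩
    rw [Expr.eq_ne, h.eval_fibreRankE h3 (by simpa [Function.update_apply] using hvL)]
    simp only [Expr.eval, Function.update_apply]
    simpa using hj.symm

theorem HoldsGraph.eval_coarsenLabelE (h : HoldsGraph L n G a)
    (h7 : ∀ i, G.NonIso i → a 7 i = G.nb i) (h3 : ∀ i < L, a 3 i = G.star i)
    (h4 : ∀ i < G.n, a 4 i ≠ 0 ↔ IsRoot G.n G.star i) (hv : v 0 < L) :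
    coarsenLabelE.eval L a v = G.coarsenLabel (v 0) := by
  classical
  rw [coarsenLabelE, Expr.eval_ite, FinGraph.coarsenLabel, Expr.eval_sub]
  simp only [h.nonIsoE_ne h7]
  rw [Expr.eval_count (Q := fun r => IsRoot G.n G.star r ∧
    (G.star r < G.star (v 0) ∨ G.star r = G.star (v 0) ∧ r ≤ v 0)) (fun i => h.eval_cardE) h.lt.le]
  · unfold groupLabel rootCount
    simp only [Expr.eval, h.eval_cardE]
  · intro i hi
    simp only [Expr.and_ne, Expr.or_ne, Expr.lt_ne, Expr.eq_ne, Expr.le_ne]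
    simp only [Expr.eval, Function.update_apply]
    norm_num only
    simp only [if_true, if_false]
    rw [h4 i hi, h3 i (hi.trans h.lt), h3 _ hv]

theorem HoldsGraph.coarsenAdjE_ne (h : HoldsGraph L n G a) (h5 : ∀ i < L, a 5 i = G.coarsenLabel i)
    {b c : ℕ} (hb : b < G.coarsen.n) (hc : c < G.coarsen.n) (hv : v 0 = 1 + (b * n + c)) :
    coarsenAdjE.eval L a v ≠ 0 ↔ G.coarsen.adj b c := by
  have hn := h.le
  have hGn := G.two_mul_coarsen_n_le
  rw [coarsenAdjE, Expr.eval, if_pos (by rw [Expr.eval]; omega), Expr.sum_ne,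
    FinGraph.adj_coarsen_iff]
  simp only [Expr.sum_ne, Expr.and_ne, h.adjE_ne, Expr.not_ne, Expr.eq_ne]
  simp only [Expr.eval, Function.update_apply]
  norm_num only
  simp only [if_true, if_false, hv]
  -- The pair `(b, c)` is determined by `b * n + c`.
  have hdec : ∀ {x y : ℕ}, x < G.coarsen.n → y < G.coarsen.n → b * n + c = x * n + y →
      x = b ∧ y = c := by
    intro x y hx hy hxy
    have h1 : b = x := by
      rcases lt_trichotomy b x with h | h | h
      · have := Nat.mul_le_mul_right n (Nat.succ_le_of_lt h)
        rw [Nat.succ_mul] at this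
        omega
      · exact h
      · have := Nat.mul_le_mul_right n (Nat.succ_le_of_lt h)
        rw [Nat.succ_mul] at this
        omega
    subst h1
    omega
  constructor
  · rintro ⟨u, hu, w, hw, hadj, hne, heq⟩
    have h1 : G.NonIso u := ⟨_, hadj⟩
    have h2 : G.NonIso w := ⟨_, hadj.symm⟩
    rw [h5 u hu, h5 w hw] at hne heq
    have hu' := h1.coarsenLabel_lt
    rw [h.row _ (by have := h.lt; omega)] at heq
    obtain ⟨h3, h4⟩ := hdec hu' h2.coarsenLabel_lt (by omega)
    exact ⟨by rwa [h3, h4] at hne, u, w, hadj, h3, h4⟩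
  · rintro ⟨hne, u, w, hadj, hu, hw⟩
    have hu' := hadj.lt_left.trans h.lt
    have hw' := hadj.lt_right.trans h.lt
    refine ⟨u, hu', w, hw', hadj, ?_, ?_⟩
    · rwa [h5 u hu', h5 w hw', hu, hw]
    · rw [h5 u hu', h5 w hw', hu, hw, h.row _ (by have := h.lt; omega)]

end Eval

/-! ### The program for one coarsening step -/

section Stage

variable {L n : ℕ} {G : FinGraph} {a : ℕ → ℕ → ℕ} {v : ℕ → ℕ} {o : List ℕ}

theorem Prog.exists_run_fill (k x : ℕ) (e : Expr) : ∃ b, (Prog.fill k x e).run L v (a, o) = (b, o) ∧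
    (∀ l, l ≠ k → b l = a l) ∧ ∀ i < L, b k i = e.eval L a (Function.update v x i) :=
  ⟨_, rfl, fun l hl => Function.update_of_ne hl _ _, fun i hi => by
    rw [Function.update_self, if_pos hi]⟩

theorem Prog.run_seq {p q : Prog} {σ : (ℕ → ℕ → ℕ) × List ℕ} :
    (Prog.seq p q).run L v σ = q.run L v (p.run L v σ) := rfl

/-- One coarsening step. The arrays `7`, `3`, `4` and `5` receive the least neighbours, the star map,
the roots and the labels of the step. Then the graph and the labels in array `2` are updated; the
number of vertices comes last, since the other updates need its old value. -/
def stageProg : Prog :=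
  .seq (.fill 7 0 nbE) <| .seq (.fill 3 0 (.var 0)) <| .seq (.loop 1 (.fill 3 0 starStepE)) <|
  .seq (.fill 4 0 isRootE) <| .seq (.fill 5 0 coarsenLabelE) <| .seq (.fill 0 0 coarsenAdjE) <|
  .seq (.fill 2 0 (.ite (.lt (.get 2 (.var 0)) cardE) (.get 5 (.get 2 (.var 0)))
    (.add cardE (.get 2 (.var 0))))) (.fill 1 0 (.count 2 cardE (.get 4 (.var 2))))

theorem HoldsGraph.exists_run_star (h : HoldsGraph L n G a)
    (h7 : ∀ i, G.NonIso i → a 7 i = G.nb i) (h3 : ∀ i < L, a 3 i = i) :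
    ∃ b, (Prog.loop 1 (.fill 3 0 starStepE)).run L v (a, o) = (b, o) ∧ (∀ l, l ≠ 3 → b l = a l) ∧
      ∀ i < L, b 3 i = G.star i := by
  have key : ∀ K : ℕ, ∃ b, (Nat.rec (a, o) (fun i τ =>
      (Prog.fill 3 0 starStepE).run L (Function.update v 1 i) τ) K :
        (ℕ → ℕ → ℕ) × List ℕ) = (b, o) ∧ (∀ l, l ≠ 3 → b l = a l) ∧
        ∀ i < L, b 3 i = G.starMap K i := by
    intro K
    induction K with
    | zero => exact ⟨a, rfl, fun _ _ => rfl, h3⟩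
    | succ K ih =>
      obtain ⟨b, hb, hl, hb3⟩ := ih
      obtain ⟨b', hb', hl', hb3'⟩ := Prog.exists_run_fill (L := L) (a := b) (o := o)
        (v := Function.update v 1 K) 3 0 starStepE
      refine ⟨b', ?_, fun l h => (hl' l h).trans (hl l h), fun i hi => ?_⟩
      · simp only [hb, hb']
      · rw [hb3' i hi, (h.congr (hl 0 (by decide)) (hl 1 (by decide))
          (hl 6 (by decide))).eval_starStepE (fun i hi => by rw [hl 7 (by decide), h7 i hi]) hb3
          (by simpa using hi)]
        simp [FinGraph.starMap]
  obtain ⟨b, hb, hl, hb3⟩ := key L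
  refine ⟨b, hb, hl, fun i hi => ?_⟩
  rw [hb3 i hi, G.starMap_eq_of_le h.lt.le]
  rfl

theorem HoldsGraph.exists_run_stage (h : HoldsGraph L n G a) {c : ℕ → ℕ}
    (hc : ∀ i < n, a 2 i = c i) : ∃ b, stageProg.run L v (a, o) = (b, o) ∧
      HoldsGraph L n G.coarsen b ∧ ∀ i < n, b 2 i = G.coarsenLabel (c i) := by
  classical
  have hGL := h.lt
  have hnL := h.n_lt
  have hcn := G.two_mul_coarsen_n_le
  have hle := h.le
  obtain ⟨a₁, r1, l1, e1⟩ := Prog.exists_run_fill (L := L) (a := a) (o := o) (v := v) 7 0 nbE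
  have g1 : HoldsGraph L n G a₁ := h.congr (l1 0 (by decide)) (l1 1 (by decide)) (l1 6 (by decide))
  have n1 : ∀ i, G.NonIso i → a₁ 7 i = G.nb i := fun i hi => by
    rw [e1 i (hi.lt.trans hGL), h.eval_nbE (by simpa using hi)]
    simp
  obtain ⟨a₂, r2, l2, e2⟩ := Prog.exists_run_fill (L := L) (a := a₁) (o := o) (v := v) 3 0 (.var 0)
  have g2 : HoldsGraph L n G a₂ := g1.congr (l2 0 (by decide)) (l2 1 (by decide)) (l2 6 (by decide))
  obtain ⟨a₃, r3, l3, e3⟩ := g2.exists_run_star (v := v) (o := o)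
    (fun i hi => by rw [l2 7 (by decide), n1 i hi])
    (fun i hi => by rw [e2 i hi]; simp [Expr.eval])
  have g3 : HoldsGraph L n G a₃ := g2.congr (l3 0 (by decide)) (l3 1 (by decide)) (l3 6 (by decide))
  have n3 : ∀ i, G.NonIso i → a₃ 7 i = G.nb i := fun i hi => by
    rw [l3 7 (by decide), l2 7 (by decide), n1 i hi]
  obtain ⟨a₄, r4, l4, e4⟩ := Prog.exists_run_fill (L := L) (a := a₃) (o := o) (v := v) 4 0 isRootE
  have g4 : HoldsGraph L n G a₄ := g3.congr (l4 0 (by decide)) (l4 1 (by decide)) (l4 6 (by decide))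
  have q4 : ∀ i < G.n, a₄ 4 i ≠ 0 ↔ IsRoot G.n G.star i := fun i hi => by
    rw [e4 i (hi.trans hGL), g3.isRootE_ne e3 (by simpa using hi)]
    simp
  obtain ⟨a₅, r5, l5, e5⟩ := Prog.exists_run_fill (L := L) (a := a₄) (o := o) (v := v) 5 0
    coarsenLabelE
  have g5 : HoldsGraph L n G a₅ := g4.congr (l5 0 (by decide)) (l5 1 (by decide)) (l5 6 (by decide))
  have q5 : ∀ i < L, a₅ 5 i = G.coarsenLabel i := fun i hi => by
    rw [e5 i hi, g4.eval_coarsenLabelE (fun i hi => by rw [l4 7 (by decide), n3 i hi])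
      (fun i hi => by rw [l4 3 (by decide), e3 i hi]) q4 (by simpa using hi)]
    simp
  obtain ⟨a₆, r6, l6, e6⟩ := Prog.exists_run_fill (L := L) (a := a₅) (o := o) (v := v) 0 0
    coarsenAdjE
  have q6 : ∀ u < G.coarsen.n, ∀ w < G.coarsen.n,
      a₆ 0 (1 + (u * n + w)) ≠ 0 ↔ G.coarsen.adj u w := by
    intro u hu w hw
    have hlt : 1 + (u * n + w) < L := by
      have := Nat.mul_le_mul_right n (show u + 1 ≤ n by omega)
      rw [Nat.succ_mul] at this
      rw [h.len]
      omega
    rw [e6 _ hlt]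
    exact g5.coarsenAdjE_ne q5 hu hw (by simp)
  have q60 : a₆ 0 0 = n := by
    rw [e6 0 (by omega)]
    simpa [coarsenAdjE, Expr.eval] using g5.stride
  obtain ⟨a₇, r7, l7, e7⟩ := Prog.exists_run_fill (L := L) (a := a₆) (o := o) (v := v) 2 0
    (.ite (.lt (.get 2 (.var 0)) cardE) (.get 5 (.get 2 (.var 0))) (.add cardE (.get 2 (.var 0))))
  have q61 : a₆ 1 0 = G.n := by rw [l6 1 (by decide), g5.card]
  have q62 : ∀ i < n, a₆ 2 i = c i := fun i hi => by
    rw [l6 2 (by decide), l5 2 (by decide), l4 2 (by decide), l3 2 (by decide), l2 2 (by decide),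
      l1 2 (by decide), hc i hi]
  have q65 : ∀ i < L, a₆ 5 i = G.coarsenLabel i := fun i hi => by rw [l6 5 (by decide), q5 i hi]
  have q7 : ∀ i < n, a₇ 2 i = G.coarsenLabel (c i) := by
    intro i hi
    rw [e7 i (hi.trans hnL), Expr.eval_ite]
    simp only [Expr.lt_ne]
    simp only [Expr.eval, cardE, Function.update_self, q61, q62 i hi]
    split_ifs with hlt
    · exact q65 _ (hlt.trans hGL)
    · rw [FinGraph.coarsenLabel, if_neg]
      exact fun hi => hlt hi.lt
  have q71 : a₇ 1 0 = G.n := by rw [l7 1 (by decide), q61]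
  obtain ⟨a₈, r8, l8, e8⟩ := Prog.exists_run_fill (L := L) (a := a₇) (o := o) (v := v) 1 0
    (.count 2 cardE (.get 4 (.var 2)))
  have q8 : a₈ 1 0 = G.coarsen.n := by
    rw [e8 0 (by omega)]
    refine Expr.eval_count (M := G.n) (Q := IsRoot G.n G.star) (by exact fun _ => q71) hGL.le
      fun i hi => ?_
    simp only [Expr.eval, Function.update_self]
    rw [l7 4 (by decide), l6 4 (by decide), l5 4 (by decide), q4 i hi]
  refine ⟨a₈, ?_, ⟨h.len, by omega, ?_, ?_, q8, fun i hi => ?_⟩, fun i hi => ?_⟩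
  · simp only [stageProg, Prog.run_seq, r1, r2, r3, r4, r5, r6, r7, r8]
  · rw [l8 0 (by decide), l7 0 (by decide), q60]
  · rw [l8 0 (by decide), l7 0 (by decide)]
    exact q6
  · rw [l8 6 (by decide), l7 6 (by decide), l6 6 (by decide), g5.row i hi]
  · rw [l8 2 (by decide), q7 i hi]

end Stage

/-! ### Codes of graphs -/

theorem List.map_finRange_eq_map_range {β : Type*} {n : ℕ} (f : Fin n → β) (g : ℕ → β)
    (h : ∀ i, f i = g i) : (List.finRange n).map f = (List.range n).map g := by
  rw [← List.map_coe_finRange_eq_range, List.map_map]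
  exact List.map_congr_left fun i _ => h i

open scoped Classical in
theorem FinGraph.code_eq (G : FinGraph) : G.code = G.n :: (List.range G.n).flatMap fun i =>
    (List.range G.n).map fun j => if G.adj i j then 1 else 0 := by
  rw [FinGraph.code, List.flatMap_def, List.flatMap_def]
  congr 2
  refine List.map_finRange_eq_map_range _ _ fun i => ?_
  refine List.map_finRange_eq_map_range _ _ fun j => ?_
  simp only [FinGraph.adj_val]

theorem length_flatMap_range_map (g : ℕ → ℕ → ℕ) (m n : ℕ) :
    ((List.range m).flatMap fun i => (List.range n).map (g i)).length = m * n := by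
  simp

theorem getD_flatMap_range_map (g : ℕ → ℕ → ℕ) {m n i j : ℕ} (hi : i < m) (hj : j < n) :
    ((List.range m).flatMap fun i => (List.range n).map (g i)).getD (i * n + j) 0 = g i j := by
  induction m with
  | zero => exact absurd hi (Nat.not_lt_zero i)
  | succ m ih =>
    rw [List.range_succ, List.flatMap_append]
    have hlen := length_flatMap_range_map g m n
    rcases Nat.lt_succ_iff_lt_or_eq.1 hi with h | rfl
    · rw [List.getD_append, ih h]
      rw [hlen]
      have := Nat.mul_le_mul_right n (Nat.succ_le_of_lt h)
      rw [Nat.succ_mul] at this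
      omega
    · rw [List.getD_append_right _ _ _ _ (by rw [hlen]; omega), hlen, Nat.add_sub_cancel_left]
      simp [List.getD, hj]

theorem FinGraph.length_code (G : FinGraph) : G.code.length = 1 + G.n * G.n := by
  rw [FinGraph.code_eq, List.length_cons, length_flatMap_range_map, add_comm]

open scoped Classical in
theorem FinGraph.getD_code {G : FinGraph} {u v : ℕ} (hu : u < G.n) (hv : v < G.n) :
    G.code.getD (1 + (u * G.n + v)) 0 = if G.adj u v then 1 else 0 := by
  rw [FinGraph.code_eq, add_comm 1, List.getD_cons_succ,
    getD_flatMap_range_map (fun i j => if G.adj i j then 1 else 0) hu hv]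

/-! ### The reducer -/

/-- Set up the arrays for the input graph. -/
def initProg : Prog :=
  .seq (.fill 1 0 (.get 0 (.lit 0))) <| .seq (.fill 2 0 (.var 0)) <|
  .fill 6 0 (.sum 2 (.ite (.lt (.var 2) (.var 0)) (.get 0 (.lit 0)) (.lit 0)))

theorem sum_range_ite_lt {L i c : ℕ} (hi : i ≤ L) :
    (∑ z ∈ Finset.range L, if z < i then c else 0) = i * c := by
  have : (Finset.range L).filter (fun z => z < i) = Finset.range i := by
    ext z
    simp only [Finset.mem_filter, Finset.mem_range]
    omega
  rw [← Finset.sum_filter, this, Finset.sum_const, Finset.card_range, smul_eq_mul]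

theorem eval_sum_ite_lt {L : ℕ} {a : ℕ → ℕ → ℕ} {v : ℕ → ℕ} {e f : Expr} {i c : ℕ}
    (he : ∀ z, e.eval L a (Function.update v 2 z) = i)
    (hf : ∀ z, f.eval L a (Function.update v 2 z) = c) (hi : i ≤ L) :
    (Expr.sum 2 (.ite (.lt (.var 2) e) f (.lit 0))).eval L a v = i * c := by
  rw [← sum_range_ite_lt hi, Expr.eval]
  refine Finset.sum_congr rfl fun z _ => ?_
  rw [Expr.eval_ite]
  simp only [Expr.lt_ne]
  simp only [he, hf, Expr.eval, Function.update_self]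

theorem exists_run_init (G : FinGraph) (v : ℕ → ℕ) :
    ∃ b, initProg.run G.code.length v (inputArrays G.code, []) = (b, []) ∧
      HoldsGraph G.code.length G.n G b ∧ ∀ i < G.n, b 2 i = i := by
  set L := G.code.length with hL
  have hlen : L = 1 + G.n * G.n := G.length_code
  have hnL : G.n < L := by nlinarith [Nat.le_mul_self G.n]
  obtain ⟨a₁, r1, l1, e1⟩ := Prog.exists_run_fill (L := L) (a := inputArrays G.code) (o := [])
    (v := v) 1 0 (.get 0 (.lit 0))
  obtain ⟨a₂, r2, l2, e2⟩ := Prog.exists_run_fill (L := L) (a := a₁) (o := []) (v := v) 2 0 (.var 0)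
  obtain ⟨a₃, r3, l3, e3⟩ := Prog.exists_run_fill (L := L) (a := a₂) (o := []) (v := v) 6 0
    (.sum 2 (.ite (.lt (.var 2) (.var 0)) (.get 0 (.lit 0)) (.lit 0)))
  have h0 : inputArrays G.code 0 0 = G.n := by
    rw [FinGraph.code_eq]
    rfl
  have h00 : ∀ i, a₃ 0 i = inputArrays G.code 0 i := fun i => by
    rw [l3 0 (by decide), l2 0 (by decide), l1 0 (by decide)]
  refine ⟨a₃, ?_, ⟨hlen, le_rfl, by rw [h00, h0], fun u hu w hw => ?_, ?_, fun i hi => ?_⟩,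
    fun i hi => ?_⟩
  · simp only [initProg, Prog.run_seq, r1, r2, r3]
  · classical
    rw [h00]
    change G.code.getD _ 0 ≠ 0 ↔ _
    rw [FinGraph.getD_code hu hw]
    simp
  · rw [l3 1 (by decide), l2 1 (by decide), e1 0 (by omega)]
    exact h0
  · rw [e3 i hi, eval_sum_ite_lt (i := i) (c := G.n) (fun z => ?_) (fun z => ?_) hi.le]
    · simp [Expr.eval]
    · simp only [Expr.eval]
      rw [l2 0 (by decide), l1 0 (by decide), h0]
  · rw [l3 2 (by decide), e2 i (hi.trans hnL)]
    simp [Expr.eval]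

/-- Set up the arrays and coarsen `k` times. -/
def stagesProg : ℕ → Prog
  | 0 => initProg
  | k + 1 => .seq (stagesProg k) stageProg

theorem exists_run_stages (G : FinGraph) (v : ℕ → ℕ) (k : ℕ) :
    ∃ b, (stagesProg k).run G.code.length v (inputArrays G.code, []) = (b, []) ∧
      HoldsGraph G.code.length G.n (G.level k) b ∧ ∀ i < G.n, b 2 i = G.label k i := by
  induction k with
  | zero => exact exists_run_init G v
  | succ k ih =>
    obtain ⟨b, hb, hG, hc⟩ := ih
    obtain ⟨b', hb', hG', hc'⟩ := hG.exists_run_stage (v := v) (o := []) hc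
    refine ⟨b', ?_, hG', hc'⟩
    rw [stagesProg, Prog.run, hb, hb']

/-- The program `p` appends `l` to the output and leaves the arrays as they are. -/
def Emits (L : ℕ) (a : ℕ → ℕ → ℕ) (p : Prog) (v : ℕ → ℕ) (l : List ℕ) : Prop :=
  ∀ o, p.run L v (a, o) = (a, o ++ l)

section Emits

variable {L : ℕ} {a : ℕ → ℕ → ℕ} {v : ℕ → ℕ}

theorem emits_emit {e : Expr} {c : ℕ} (h : e.eval L a v = c) : Emits L a (.emit e) v [c] :=
  fun o => by rw [Prog.run, h]

theorem Emits.seq {p q : Prog} {l l' : List ℕ} (hp : Emits L a p v l) (hq : Emits L a q v l') :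
    Emits L a (.seq p q) v (l ++ l') :=
  fun o => by rw [Prog.run, hp o, hq, List.append_assoc]

theorem Emits.loop {x M : ℕ} {e : Expr} {p : Prog} {g : ℕ → List ℕ} (hM : M ≤ L)
    (he : ∀ i, e.eval L a (Function.update v x i) = M)
    (hp : ∀ i < M, Emits L a p (Function.update v x i) (g i)) :
    Emits L a (.loop x (.cond (.lt (.var x) e) p)) v ((List.range M).flatMap g) := by
  intro o
  have key : ∀ K : ℕ, (Nat.rec (a, o) (fun i τ => (Prog.cond (.lt (.var x) e) p).run L
      (Function.update v x i) τ) K : (ℕ → ℕ → ℕ) × List ℕ) =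
        (a, o ++ (List.range (min K M)).flatMap g) := by
    intro K
    induction K with
    | zero => simp
    | succ K ih =>
      simp only [ih]
      rw [Prog.run]
      simp only [Expr.lt_ne, he]
      simp only [Expr.eval, Function.update_self]
      split_ifs with hK
      · rw [hp K hK, show min (K + 1) M = min K M + 1 by omega, List.range_succ,
          List.flatMap_append, show min K M = K by omega, List.append_assoc]
        simp
      · rw [show min (K + 1) M = min K M by omega]
  rw [Prog.run, key L, min_eq_right hM]

end Emits

/-- Write the labels and the code of the current graph. -/
def outputProg : Prog :=
  .seq (.emit (.lit 2)) <| .seq (.emit (.get 0 (.lit 0))) <|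
  .seq (.loop 0 (.cond (.lt (.var 0) (.get 0 (.lit 0))) (.emit (.get 2 (.var 0))))) <|
  .seq (.emit (.add (.lit 1) (.sum 2 (.ite (.lt (.var 2) cardE) cardE (.lit 0))))) <|
  .seq (.emit cardE) <|
  .loop 0 (.cond (.lt (.var 0) cardE) (.loop 1 (.cond (.lt (.var 1) cardE)
    (.emit (.ite (adjE (.var 0) (.var 1)) (.lit 1) (.lit 0))))))

theorem HoldsGraph.emits_output {L n : ℕ} {G : FinGraph} {a : ℕ → ℕ → ℕ} (v : ℕ → ℕ)
    (h : HoldsGraph L n G a) {c : ℕ → ℕ} (hc : ∀ i < n, a 2 i = c i) :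
    Emits L a outputProg v (packWords [(List.range n).map c, G.code]) := by
  classical
  have h1 := emits_emit (L := L) (a := a) (v := v) (e := .lit 2) rfl
  have h2 := emits_emit (L := L) (a := a) (v := v) (e := .get 0 (.lit 0)) h.stride
  have h3 := Emits.loop (L := L) (a := a) (v := v) (x := 0) (e := .get 0 (.lit 0))
    (p := .emit (.get 2 (.var 0))) (g := fun i => [c i]) h.n_lt.le (fun i => h.stride)
    (fun i hi => emits_emit (by simp [Expr.eval, hc i hi]))
  have h4 := emits_emit (L := L) (a := a) (v := v)
    (e := .add (.lit 1) (.sum 2 (.ite (.lt (.var 2) cardE) cardE (.lit 0))))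
    (c := 1 + G.n * G.n) (by
      rw [← eval_sum_ite_lt (v := v) (e := cardE) (f := cardE) (fun z => h.eval_cardE)
        (fun z => h.eval_cardE) h.lt.le]
      rfl)
  have h5 := emits_emit (L := L) (a := a) (v := v) h.eval_cardE
  have h6 := Emits.loop (L := L) (a := a) (v := v) (x := 0) (e := cardE)
    (p := .loop 1 (.cond (.lt (.var 1) cardE)
      (.emit (.ite (adjE (.var 0) (.var 1)) (.lit 1) (.lit 0)))))
    (g := fun i => (List.range G.n).flatMap fun j => [if G.adj i j then 1 else 0]) h.lt.le
    (fun i => h.eval_cardE)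
    (fun i hi => Emits.loop h.lt.le (fun i => h.eval_cardE) fun j hj => emits_emit (by
      rw [Expr.eval_ite]
      simp only [h.adjE_ne]
      simp [Expr.eval]))
  have key := h1.seq (h2.seq (h3.seq (h4.seq (h5.seq h6))))
  have heq : packWords [(List.range n).map c, G.code] = [2] ++ ([n] ++
      ((List.range n).flatMap (fun i => [c i]) ++ ([1 + G.n * G.n] ++ ([G.n] ++
      (List.range G.n).flatMap fun i =>
        (List.range G.n).flatMap fun j => [if G.adj i j then 1 else 0])))) := by
    simp only [packWords, List.flatMap_cons, List.flatMap_nil, G.length_code]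
    rw [G.code_eq]
    simp [← List.map_eq_flatMap]
  rw [heq]
  exact key

/-- The labels of the vertices after `k` coarsening steps. -/
def labelWord (k : ℕ) (G : FinGraph) : List ℕ := (List.range G.n).map (G.label k)

theorem polyTime_reducer (k : ℕ) : PolyTime FinGraph.code
    (fun G => packWords [labelWord k G, (G.level k).code]) := by
  refine polyTime_of_run (.seq (stagesProg k) outputProg) fun G => ?_
  obtain ⟨b, hb, hG, hc⟩ := exists_run_stages G (fun _ => 0) k
  rw [Prog.run, hb, hG.emits_output _ hc]
  rfl

/-! ### The merger -/

theorem getD_append_cons_length {A B : List ℕ} {x : ℕ} : (A ++ x :: B).getD A.length 0 = x := by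
  rw [List.getD_append_right _ _ _ _ le_rfl, Nat.sub_self]
  rfl

theorem getD_append_cons_add {A B : List ℕ} {x i : ℕ} :
    (A ++ x :: B).getD (A.length + 1 + i) 0 = B.getD i 0 := by
  rw [List.getD_append_right _ _ _ _ (by omega), show A.length + 1 + i - A.length = i + 1 by omega]
  rfl

theorem packWords_three (w₀ w₁ w₂ : List ℕ) : packWords [w₀, w₁, w₂] =
    3 :: w₀.length :: (w₀ ++ w₁.length :: (w₁ ++ w₂.length :: w₂)) := by
  simp [packWords]

/-- The label of vertex `e`. The input of the merger is the word `3`, `l`, `w`, `n`, …, in which `w` is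
the code of the graph and `l` is its length. So the labels start at entry `3 + l`, and entry `2`, the
first one of `w`, is the number `n` of vertices. -/
def labelE (e : Expr) : Expr := .get 0 (.add (.add (.lit 3) (.get 0 (.lit 1))) e)

/-- The number of vertices of the coarsened graph. It is the length of the word of positions, and is
written right after the `n` labels. -/
def levelCardE : Expr := labelE (.get 0 (.lit 2))

/-- The position of vertex `e` of the coarsened graph. -/
def positionE (e : Expr) : Expr :=
  .get 0 (.add (.add (.add (.lit 4) (.get 0 (.lit 1))) (.get 0 (.lit 2))) e)

/-- Sort the vertices by the positions of their classes. -/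
def mergeProg : Prog :=
  .seq (.fill 1 0 (.ite (.lt (labelE (.var 0)) levelCardE) (positionE (labelE (.var 0)))
    (labelE (.var 0)))) <|
  .loop 0 (.cond (.lt (.var 0) (.get 0 (.lit 2))) (.emit (.count 2 (.get 0 (.lit 2))
    (.or (.lt (.get 1 (.var 2)) (.get 1 (.var 0)))
      (.and (.eq (.get 1 (.var 2)) (.get 1 (.var 0))) (.lt (.var 2) (.var 0)))))))

open scoped Classical in
theorem FinGraph.mergeOrdering_val (G : FinGraph) (k : ℕ) (π : VertexOrdering (Fin (G.level k).n))
    (v : Fin G.n) : (G.mergeOrdering k π v : ℕ) = ((Finset.range G.n).filter fun u =>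
      G.mergeKey k π u < G.mergeKey k π v ∨
        G.mergeKey k π u = G.mergeKey k π v ∧ u < (v : ℕ)).card := by
  rw [FinGraph.mergeOrdering, keyOrdering_val, keyRank,
    ← Set.ncard_image_of_injective _ Fin.val_injective, ← Set.ncard_coe_finset]
  congr 1
  ext u
  simp only [Set.mem_image, Set.mem_ofPred_eq, sortKey_lt_iff, Finset.coe_filter, Finset.mem_range]
  constructor
  · rintro ⟨w, hw, rfl⟩
    exact ⟨w.2, hw⟩
  · rintro ⟨hu, h⟩
    exact ⟨⟨u, hu⟩, h, rfl⟩

theorem run_mergeProg (G : FinGraph) (k : ℕ) (π : VertexOrdering (Fin (G.level k).n))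
    {w : List ℕ} (hw : w = packWords [G.code, labelWord k G,
      (List.finRange (G.level k).n).map fun v => (π v : ℕ)]) :
    (mergeProg.run w.length (fun _ => 0) (inputArrays w, [])).2 =
      (List.finRange G.n).map fun v => (G.mergeOrdering k π v : ℕ) := by
  classical
  set πw := (List.finRange (G.level k).n).map fun v => (π v : ℕ) with hπw
  have hlabel : (labelWord k G).length = G.n := by simp [labelWord]
  have hπlen : πw.length = (G.level k).n := by simp [hπw]
  have hcode := G.length_code
  rw [packWords_three] at hw
  have hwlen : G.n ≤ w.length := by
    rw [hw]
    simp only [List.length_cons, List.length_append, hlabel]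
    omega
  have hw1 : w.getD 1 0 = 1 + G.n * G.n := by
    rw [hw, ← hcode]
    rfl
  have hw2 : w.getD 2 0 = G.n := by
    rw [hw, FinGraph.code_eq]
    rfl
  have hw3 : ∀ i < G.n, w.getD (3 + (1 + G.n * G.n) + i) 0 = G.label k i := by
    intro i hi
    have : w = (3 :: G.code.length :: G.code) ++ (labelWord k G).length ::
        (labelWord k G ++ πw.length :: πw) := hw
    rw [this, show 3 + (1 + G.n * G.n) + i = (3 :: G.code.length :: G.code).length + 1 + i by
      simp only [List.length_cons, hcode]; omega, getD_append_cons_add,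
      List.getD_append _ _ _ _ (by omega)]
    simp [labelWord, List.getD, hi]
  have hw' : w = (3 :: G.code.length :: G.code ++ (labelWord k G).length :: labelWord k G) ++
      πw.length :: πw := by
    rw [hw]
    simp
  have hlen' : (3 :: G.code.length :: G.code ++ (labelWord k G).length :: labelWord k G).length =
      3 + (1 + G.n * G.n) + G.n := by
    simp only [List.length_cons, List.length_append, hcode, hlabel]
    omega
  have hw4 : w.getD (3 + (1 + G.n * G.n) + G.n) 0 = (G.level k).n := by
    rw [hw', ← hlen', getD_append_cons_length, hπlen]
  have hw5 : ∀ i (hi : i < (G.level k).n), w.getD (4 + (1 + G.n * G.n) + G.n + i) 0 =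
      π ⟨i, hi⟩ := by
    intro i hi
    rw [hw', show 4 + (1 + G.n * G.n) + G.n + i = 3 + (1 + G.n * G.n) + G.n + 1 + i by omega,
      ← hlen', getD_append_cons_add]
    simp [hπw, List.getD, hi]
  obtain ⟨b, r, l, e⟩ := Prog.exists_run_fill (L := w.length) (a := inputArrays w) (o := [])
    (v := fun _ => 0) 1 0 (.ite (.lt (labelE (.var 0)) levelCardE)
      (positionE (labelE (.var 0))) (labelE (.var 0)))
  have hin : ∀ i, inputArrays w 0 i = w.getD i 0 := fun i => rfl
  have hb2 : b 0 2 = G.n := by rw [l 0 (by decide), hin, hw2]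
  have hb : ∀ i < G.n, b 1 i = G.mergeKey k π i := by
    intro i hi
    rw [e i (by omega), Expr.eval_ite, FinGraph.mergeKey]
    simp only [Expr.lt_ne]
    simp only [labelE, levelCardE, positionE, Expr.eval, hin, hw1, hw2, Function.update_self,
      hw3 i hi, hw4]
    split_ifs with hlt
    · exact hw5 _ hlt
    · rfl
  have hem := Emits.loop (L := w.length) (a := b) (v := fun _ => 0) (x := 0)
    (e := .get 0 (.lit 2)) (p := .emit (.count 2 (.get 0 (.lit 2))
    (.or (.lt (.get 1 (.var 2)) (.get 1 (.var 0)))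
      (.and (.eq (.get 1 (.var 2)) (.get 1 (.var 0))) (.lt (.var 2) (.var 0))))))
    (g := fun i => [((Finset.range G.n).filter fun u =>
      G.mergeKey k π u < G.mergeKey k π i ∨
        G.mergeKey k π u = G.mergeKey k π i ∧ u < i).card]) hwlen (fun i => hb2)
    (fun i hi => emits_emit (Expr.eval_count (fun j => hb2) hwlen fun u hu => by
      simp only [Expr.and_ne, Expr.or_ne, Expr.lt_ne, Expr.eq_ne]
      simp only [Expr.eval, Function.update_apply]
      norm_num only
      simp only [if_true, if_false]
      rw [hb u hu, hb i hi]))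
  rw [mergeProg, Prog.run, r, hem]
  rw [List.map_finRange_eq_map_range _ (fun i => ((Finset.range G.n).filter fun u =>
    G.mergeKey k π u < G.mergeKey k π i ∨
      G.mergeKey k π u = G.mergeKey k π i ∧ u < i).card) (G.mergeOrdering_val k π)]
  simp [← List.map_eq_flatMap]

theorem polyTime_merger (k : ℕ) : PolyTime
    (A := Σ G : FinGraph, VertexOrdering (Fin (G.level k).n))
    (fun x => packWords [x.1.code, labelWord k x.1,
      (List.finRange (x.1.level k).n).map fun v => (x.2 v : ℕ)])
    (fun x => (List.finRange x.1.n).map fun v => (x.1.mergeOrdering k x.2 v : ℕ)) :=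
  polyTime_of_run mergeProg fun x => run_mergeProg x.1 k x.2 rfl

/-! ### The reductions -/

/-- The reduction that coarsens `k` times. -/
def coarsenReduction (k : ℕ) : Reduction bandwidthProblem where
  reduce G := [FinGraph.level G k]
  info := labelWord k
  merge G S := FinGraph.mergeOrdering G k (S ⟨0, Nat.one_pos⟩)

theorem isPolyTime_coarsenReduction (k : ℕ) : (coarsenReduction k).IsPolyTime := by
  refine ⟨polyTime_reducer k, ?_⟩
  obtain ⟨p, q, h⟩ := polyTime_merger k
  exact ⟨p, q, fun x => h ⟨x.1, x.2 ⟨0, Nat.one_pos⟩⟩⟩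

theorem hasRateApprox_coarsenReduction (k : ℕ) :
    (coarsenReduction k).HasRateApprox (2 ^ k) (fun α => 9 ^ k * α) 0 where
  size_le := by
    intro G J hJ
    obtain rfl : J = FinGraph.level G k := List.mem_singleton.1 hJ
    have h := FinGraph.pow_mul_level_n_le G k
    have h' : (2 : ℝ) ^ k * ((FinGraph.level G k).n : ℝ) ≤ (FinGraph.n G : ℝ) := by
      exact_mod_cast h
    rw [add_zero, le_div_iff₀ (by positivity), mul_comm]
    exact h'
  cost_le := by
    intro G S α hα hS
    exact FinGraph.mergeOrdering_cost_le G k _ α hα (hS ⟨0, Nat.one_pos⟩)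

end

theorem mainTheorem6 :
    (∀ (V : Type) [Finite V] (G : SimpleGraph V), (∀ v, ∃ w, G.Adj v w) →
      2 ≤ graphBandwidth G → ∀ M : G.Subgraph, IsMaximumMatching G M →
      ∃ ρ : V → V, IsContractionMap G ρ ∧
        (∀ u w, M.Adj u w → (ρ u = u ∧ ρ w = u) ∨ (ρ u = w ∧ ρ w = w)) ∧
        graphBandwidth (contractGraph G ρ) + 1 ≤ 3 * graphBandwidth G) ∧
    (∃ R : Reduction bandwidthProblem, R.IsPolyTime ∧
      R.HasRateApprox 2 (fun α => 9 * α) 0 ∧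
      ∀ G : FinGraph, ∃ G' : FinGraph, R.reduce G = [G'] ∧
        (2 ≤ graphBandwidth G.graph →
          (∃ ρ : G.graph.support → G.graph.support,
            IsContractionMap (G.graph.induce G.graph.support) ρ ∧
            Nonempty (G'.graph ≃g contractGraph (G.graph.induce G.graph.support) ρ)) ∧
          graphBandwidth G'.graph + 1 ≤ 3 * graphBandwidth G.graph)) ∧
    (∀ k : ℕ, ∃ R : Reduction bandwidthProblem, R.IsPolyTime ∧
      R.HasRateApprox (2 ^ k) (fun α => 9 ^ k * α) 0) := by
  refine ⟨fun V _ G hG hb M hM =>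
    exists_isContractionMap_of_isMaximumMatching hG (by omega) hM, ?_,
    fun k => ⟨_, isPolyTime_coarsenReduction k, hasRateApprox_coarsenReduction k⟩⟩
  refine ⟨_, isPolyTime_coarsenReduction 1, by simpa using hasRateApprox_coarsenReduction 1,
    fun G => ⟨G.coarsen, rfl, fun hb => ⟨G.exists_contraction_coarsen,
      G.graphBandwidth_coarsen_lt (by omega)⟩⟩⟩
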